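/- Consider deterministic synchronous message-passing algorithms on an $n$-node graph $G=(V,E)$ of maximum degree at most $\Delta\ge 1$. Every node numbers its incident edges arbitrarily by ports. Initially each node knows $m$, $\Delta$ and its own color in some proper $m$-coloring of $G$ (for example, its unique ID from a space of size $m$). In each round every node sends one message to each of its neighbors, receives the messages of its neighbors, and performs an arbitrary local computation; after the last round each node outputs a color. An algorithm is a CONGEST algorithm if all messages have $O(\log n)$ bits, where $m\le n^{c}$ for a constant $c$ (input colors or IDs of $O(\log n)$ bits). Let $\log^* n$ be the least $k$ such that the $k$-fold iterate of $\log_2$ at $n$ is at most $1$. For every constant $\varepsilon>0$ there is a deterministic CONGEST algorithm that computes a proper vertex coloring of $G$ with $O(\Delta^{1+\varepsilon})$ colors in $O(\Delta^{1/2-\varepsilon/2})+\log^* n$ rounds. More precisely: for every $\varepsilon>0$ there are a deterministic algorithm and a constant $K$ such that for every $c\in\mathbb N$ there are constants $B$ and $R$ with the following property. For every $n$-node graph $G$ with any port numbering, every $\Delta\ge 1$ that bounds the maximum degree of $G$, and every proper input coloring of $G$ with $m\le n^{c}$ colors, the algorithm takes at most $R\,\Delta^{1/2-\varepsilon/2}+\log^*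 n$ rounds, sends only messages of at most $B\lceil\log_2 n\rceil$ bits, and its outputs form a proper coloring of $G$ with colors that are non-negative integers less than $K\Delta^{1+\varepsilon}$. -/

import Mathlib

/-- The iterated logarithm `log* n` (base `2`): the least number of times that `log₂` has to be
applied, starting from `n`, until the value is at most `1`. -/
noncomputable def logStar (n : ℕ) : ℕ :=
  sInf {k : ℕ | (Real.logb 2)^[k] (n : ℝ) ≤ 1}

/-- The infimum in `logStar` is over a nonempty set, hence attained. -/
theorem logStar_set_nonempty (n : ℕ) : {k : ℕ | (Real.logb 2)^[k] (n : ℝ) ≤ 1}.Nonempty := by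
  by_contra h
  rw [Set.not_nonempty_iff_eq_empty, Set.eq_empty_iff_forall_notMem] at h
  simp only [Set.mem_ofPred_eq, not_le] at h
  have step : ∀ x : ℝ, 1 < x → 1 < Real.logb 2 x → Real.logb 2 x ≤ x - 1 / 4 := by
    intro x hx hl
    have h2 : 2 < x := by
      have := (Real.lt_logb_iff_rpow_lt (by norm_num) (by linarith)).1 hl
      simpa using this
    rw [Real.logb, div_le_iff₀ (Real.log_pos (by norm_num))]
    have e : Real.log x = Real.log (x / 2) + Real.log 2 := by
      rw [← Real.log_mul (by linarith) (by norm_num)]; congr 1; ring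
    have h3 : Real.log (x / 2) ≤ x / 2 - 1 := Real.log_le_sub_one_of_pos (by linarith)
    have h4 := Real.log_two_gt_d9
    nlinarith
  have bound : ∀ k : ℕ, (Real.logb 2)^[k] (n : ℝ) ≤ n - k / 4 := by
    intro k
    induction k with
    | zero => simp
    | succ k ih =>
      have h1 := h (k + 1)
      rw [Function.iterate_succ_apply'] at h1 ⊢
      have := step _ (h k) h1
      push_cast
      linarith
  have h1 := bound (4 * n)
  have h2 := h (4 * n)
  push_cast at h1
  linarith

/-- A deterministic synchronous message-passing algorithm. All nodes run the same code. Initially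
a node knows the global parameters `m` (the number of input colors) and `Δ` (the bound on the
degrees), and its own input color. In each round it sends one bit string through each of its ports,
receives the list of the bit strings that its neighbors sent to it (in the order of its own
ports), and updates its state. After `rounds m Δ` rounds it outputs a color. Local
computation is unrestricted. -/
structure DistAlgorithm where
  /-- the local states of a node -/
  State : Type
  /-- the initial state, from `m`, `Δ` and the node's own input color -/
  init : (m Δ color : ℕ) → State
  /-- the message sent through a given port -/
  send : State → (port : ℕ) → List Bool
  /-- the new state after the messages of the round have arrived -/
  receive : State → List (List Bool) → State
  /-- the number of communication rounds -/
  rounds : (m Δ : ℕ) → ℕ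
  /-- the output color -/
  output : State → ℕ

section Execution

variable {V : Type*} [Fintype V]

/-- A port numbering: every node `v` numbers its incident edges `0, …, deg v - 1`. -/
abbrev PortNumbering (G : SimpleGraph V) [DecidableRel G.Adj] : Type _ :=
  ∀ v : V, Fin (G.degree v) ≃ G.neighborSet v

namespace DistAlgorithm

variable (A : DistAlgorithm) {G : SimpleGraph V} [DecidableRel G.Adj] (P : PortNumbering G)
  (Δ : ℕ) {m : ℕ} (φ : G.Coloring (Fin m))

/-- The state of a node after `t` rounds, on the graph `G` with ports `P`, degree bound `Δ` and
input coloring `φ`. -/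
def stateAt : ℕ → V → A.State
  | 0, v => A.init m Δ (φ v)
  | t + 1, v =>
      A.receive (stateAt t v) <| List.ofFn fun i : Fin (G.degree v) =>
        -- `P v i` is the neighbor of `v` behind port `i`; it sends through its own port to `v`.
        A.send (stateAt t (P v i)) ((P (P v i)).symm ⟨v, (P v i).2.symm⟩)

/-- The color that a node has computed at the end. -/
def result (v : V) : ℕ := A.output (A.stateAt P Δ φ (A.rounds m Δ) v)

/-- In every round, every message sent along an edge has at most `b` bits. -/
def MessagesBounded (b : ℕ) : Prop :=
  ∀ t < A.rounds m Δ, ∀ (v : V) (i : Fin (G.degree v)),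
    (A.send (A.stateAt P Δ φ t v) i).length ≤ b

end DistAlgorithm

end Execution

/-! Everything rests on low-degree polynomials over a prime field. A color `i < q ^ d` is read as a
polynomial of degree at most `d` without constant term. Two different such curves agree in at most
`d` points, even after one of them is shifted by a constant (`card_curve_eq_add_le`).

Color reduction (Linial): if `Δ * d < q`, every node finds a point of its curve that lies on no
neighbor's curve, and takes this point as its new color among `q ^ 2` (`reduceStep_proper`). The
palette size divided by `Δ ^ 2` thereby drops from `w` to about `4 * (log₂ w) ^ 2`, so `log* n +
O(1)` rounds reach `O(Δ ^ 2)` colors. For `ε ≥ 1` this suffices.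

For `ε < 1`, let `Q` be of order `Δ ^ (1/2 - ε/2)`, and `β` and `q` of order `Δ ^ (1/2 + ε/2)`. In
`Q` rounds the nodes form `Q` classes such that every node has at most `β` neighbors in its class
that joined no later than itself (`classes_of_recursion`). The reason is double counting: a neighbor
obstructs at most `2 * d` rounds, and `2 * d * Δ < Q * (β + 1)`.

The classes are then colored one after the other, two rounds each, with points of the plane over the
field of size `q` (`coloring_of_finalStep`). By averaging, some shift of a node's curve meets at
most `Δ / q < q / 2` points that are final colors of neighbors. The at most `β` neighbors in its
class that joined no later block at most `β * d < q / 2` further points, whatever they choose. So a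
free point remains. This costs `q ^ 2 = O(Δ ^ (1 + ε))` colors and `3 * Q` rounds after the
reduction. -/

/-! ### Iterated color reduction: the size of the palette -/

/-- If `Δ ^ 2 * w` bounds the size of the palette before a round of color reduction, then
`Δ ^ 2 * paletteFactor w` bounds it afterwards. -/
def paletteFactor (w : ℕ) : ℕ := 4 * (max 4 (Nat.clog 2 w)) ^ 2

theorem four_mul_add_ten_sq_le_two_pow (k : ℕ) : 4 * (k + 10) ^ 2 ≤ 2 ^ (k + 9) := by
  induction k with
  | zero => norm_num
  | succ k ih =>
    have h : 4 * (k + 1 + 10) ^ 2 ≤ 2 * (4 * (k + 10) ^ 2) :=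
      le_of_le_of_eq (Nat.le_add_right _ (4 * k ^ 2 + 72 * k + 316)) (by ring)
    rw [show k + 1 + 9 = (k + 9) + 1 by ring, pow_succ _ (k + 9)]
    omega

theorem paletteFactor_le_of_le {w : ℕ} (hw : w ≤ 324) : paletteFactor w ≤ 324 := by
  have : Nat.clog 2 w ≤ 9 := Nat.clog_le_of_le_pow (hw.trans (by norm_num))
  have h : max 4 (Nat.clog 2 w) ≤ 9 := by omega
  calc paletteFactor w ≤ 4 * 9 ^ 2 := Nat.mul_le_mul_left 4 (Nat.pow_le_pow_left h 2)
    _ = 324 := by norm_num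

/-- The threshold is `324 = 4 * 9 ^ 2`, reproduced by the recursion because `clog 2 324 = 9`. Beyond
it, `w > 2 ^ (k - 1)` outgrows `4 * k ^ 2`. -/
theorem paletteFactor_lt {w : ℕ} (hw : 324 < w) : paletteFactor w < w := by
  set k := Nat.clog 2 w with hk
  have h1 : 2 ^ (k - 1) < w := by
    by_contra! h
    have := Nat.clog_le_of_le_pow h
    have h0 : 0 < k := Nat.clog_pos (by norm_num) (by omega)
    omega
  have h9 : 9 ≤ k := by
    by_contra! h
    have h2 : w ≤ 2 ^ k := Nat.le_pow_clog (by norm_num) w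
    have h3 : 2 ^ k ≤ 2 ^ 8 := Nat.pow_le_pow_right (by norm_num) (by omega)
    norm_num at h3
    omega
  have hmax : max 4 k = k := by omega
  unfold paletteFactor
  rw [← hk, hmax]
  rcases h9.eq_or_lt with h | h
  · rw [← h]; simpa using hw
  · obtain ⟨j, hj⟩ := Nat.exists_eq_add_of_le' (show 10 ≤ k by omega)
    rw [hj] at h1 ⊢
    exact (four_mul_add_ten_sq_le_two_pow j).trans_lt (by simpa using h1)

theorem iterate_paletteFactor_le (w i : ℕ) : paletteFactor^[i] w ≤ max 324 (w - i) := by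
  induction i with
  | zero => simp
  | succ i ih =>
    rw [Function.iterate_succ_apply']
    rcases le_or_gt (paletteFactor^[i] w) 324 with h | h
    · exact (paletteFactor_le_of_le h).trans (le_max_left _ _)
    · have := paletteFactor_lt h
      omega

/-! ### Comparison of the palette factor with the iterated logarithm -/

theorem natCast_clog_le {w : ℕ} {a : ℝ} (ha : 1 ≤ a) (h : (w : ℝ) ≤ a) :
    (Nat.clog 2 w : ℝ) ≤ 1 + Real.logb 2 a := by
  have ha' : 0 ≤ Real.logb 2 a := Real.logb_nonneg (by norm_num) ha
  rcases Nat.eq_zero_or_pos w with rfl | hw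
  · simp; linarith
  have hw' : (1 : ℝ) ≤ w := by exact_mod_cast hw
  have h0 : 0 ≤ Real.logb 2 w := Real.logb_nonneg (by norm_num) hw'
  have h1 := Nat.ceil_lt_add_one h0
  have h2 : Real.logb 2 w ≤ Real.logb 2 a :=
    Real.logb_le_logb_of_le (by norm_num) (by linarith) h
  have h3 := Real.natCeil_logb_natCast 2 w
  push_cast at h3
  rw [h3] at h1
  linarith

theorem logStar_iterate_le (n : ℕ) : (Real.logb 2)^[logStar n] (n : ℝ) ≤ 1 :=
  Nat.sInf_mem (logStar_set_nonempty n)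

theorem one_lt_iterate_of_lt_logStar {n i : ℕ} (h : i < logStar n) :
    1 < (Real.logb 2)^[i] (n : ℝ) := by
  by_contra! h'
  exact absurd (Nat.sInf_le (s := {k : ℕ | (Real.logb 2)^[k] (n : ℝ) ≤ 1}) h') (not_le.2 h)

/-- Along the iterates of `log₂`, the palette factor stays polynomial in the iterate. -/
theorem iterate_paletteFactor_le_rpow (n m e k : ℕ) (he : 2 ≤ e) (hm : m ≤ n ^ e)
    (hk : 4 * (4 + k + e) ^ 2 ≤ 2 ^ k) (i : ℕ) (hi : i ≤ logStar n) :
    ((paletteFactor^[i] m : ℕ) : ℝ) ≤ 2 ^ k * (max ((Real.logb 2)^[i] (n : ℝ)) 1) ^ e := by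
  induction i with
  | zero =>
    have h1 : (m : ℝ) ≤ (n : ℝ) ^ e := by exact_mod_cast hm
    have h2 : (n : ℝ) ^ e ≤ (max (n : ℝ) 1) ^ e := by gcongr; exact le_max_left _ _
    have h3 : (1 : ℝ) ≤ 2 ^ k := one_le_pow₀ (by norm_num)
    have h4 : (0 : ℝ) ≤ (max (n : ℝ) 1) ^ e := by positivity
    simp only [Function.iterate_zero, id]
    nlinarith
  | succ i ih =>
    have hy := one_lt_iterate_of_lt_logStar (Nat.lt_of_succ_le hi)
    have ih := ih (by omega)
    rw [Function.iterate_succ_apply', Function.iterate_succ_apply']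
    set y := (Real.logb 2)^[i] (n : ℝ)
    set w := paletteFactor^[i] m
    rw [max_eq_left hy.le] at ih
    set Y := max (Real.logb 2 y) 1
    have hY1 : 1 ≤ Y := le_max_right _ _
    have hYl : Real.logb 2 y ≤ Y := le_max_left _ _
    have hye : (1 : ℝ) ≤ y ^ e := one_le_pow₀ hy.le
    have h2k : (1 : ℝ) ≤ 2 ^ k := one_le_pow₀ (by norm_num)
    -- The logarithm of the inductive bound is `k + e * logb 2 y`, linear in the next iterate. Its
    -- square is absorbed by the power `e ≥ 2`, and the constants by `2 ^ k`, so the bound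
    -- reproduces itself.
    have hc := natCast_clog_le (by nlinarith) ih
    rw [Real.logb_mul (by positivity) (by positivity), Real.logb_pow, Real.logb_pow,
      Real.logb_self_eq_one (by norm_num)] at hc
    have he0 : (0 : ℝ) ≤ e := by positivity
    have hk0 : (0 : ℝ) ≤ k := by positivity
    have hb : ((max 4 (Nat.clog 2 w) : ℕ) : ℝ) ≤ (4 + k + e) * Y := by
      push_cast
      refine max_le ?_ ?_ <;> nlinarith
    have hk' : (4 : ℝ) * (4 + k + e) ^ 2 ≤ 2 ^ k := by exact_mod_cast hk
    have hYe : Y ^ 2 ≤ Y ^ e := pow_le_pow_right₀ hY1 he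
    unfold paletteFactor
    push_cast at hb ⊢
    calc (4 : ℝ) * (max 4 (Nat.clog 2 w : ℝ)) ^ 2 ≤ 4 * ((4 + k + e) * Y) ^ 2 := by gcongr
      _ = (4 * (4 + k + e) ^ 2) * Y ^ 2 := by ring
      _ ≤ 2 ^ k * Y ^ e := by gcongr

/-- `log* n` rounds bring the palette factor down to a constant. -/
theorem exists_iterate_paletteFactor_logStar_le (c : ℕ) :
    ∃ a : ℕ, ∀ n m : ℕ, m ≤ n ^ c → paletteFactor^[logStar n] m ≤ a := by
  -- With `e = c + 2` and `k = 2 * e + 20` the left side is `36 * (e + 8) ^ 2`. Enlarging `c` by 2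
  -- ensures `2 ≤ e`.
  have hk : 4 * (4 + (2 * (c + 2) + 20) + (c + 2)) ^ 2 ≤ 2 ^ (2 * (c + 2) + 20) := by
    have h : c + 2 + 8 ≤ 8 * 2 ^ (c + 2) := by
      have := Nat.lt_two_pow_self (n := c + 2)
      omega
    calc 4 * (4 + (2 * (c + 2) + 20) + (c + 2)) ^ 2 = 36 * (c + 2 + 8) ^ 2 := by ring
      _ ≤ 36 * (8 * 2 ^ (c + 2)) ^ 2 := by gcongr
      _ = 2304 * 2 ^ (2 * (c + 2)) := by rw [mul_pow, ← pow_mul]; ring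
      _ ≤ 2 ^ (2 * (c + 2) + 20) := by rw [pow_add]; nlinarith [Nat.zero_le (2 ^ (2 * (c + 2)))]
  refine ⟨2 ^ (2 * (c + 2) + 20), fun n m hm => ?_⟩
  have hm' : m ≤ n ^ (c + 2) ∨ n = 0 := by
    rcases Nat.eq_zero_or_pos n with h | h
    · exact Or.inr h
    · exact Or.inl (hm.trans (Nat.pow_le_pow_right h (by omega)))
  rcases hm' with hm' | rfl
  · have h1 := iterate_paletteFactor_le_rpow n m (c + 2) _ (by omega) hm' hk _ le_rfl
    rw [max_eq_right (logStar_iterate_le n), one_pow, mul_one] at h1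
    exact_mod_cast h1
  · have h0 : logStar 0 = 0 := Nat.sInf_eq_zero.2 (Or.inl (by simp))
    rw [h0]
    have : (0 : ℕ) ^ c ≤ 1 := by rcases c with _ | c <;> simp
    exact (hm.trans this).trans Nat.one_le_two_pow

/-! ### Palette sizes and number of rounds of the color reduction -/

/-- The number of colors after one round of color reduction from `M` colors is the square of a
prime `q` for which some `d` satisfies this condition. -/
def IsReductionPrime (Δ M q : ℕ) : Prop := q.Prime ∧ ∃ d, M ≤ q ^ d ∧ Δ * d < q

/-- Bertrand's postulate gives a prime between `Δ * d` and `2 * Δ * d`. As `d ≥ 4`, this prime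
exceeds `2 * Δ`, and its `d`-th power covers both `Δ ^ 2` and `w ≤ 2 ^ d`. -/
theorem exists_isReductionPrime_le {Δ M w : ℕ} (hΔ : 1 ≤ Δ) (hM : M ≤ Δ ^ 2 * w) :
    ∃ q, IsReductionPrime Δ M q ∧ q ≤ 2 * (Δ * max 4 (Nat.clog 2 w)) := by
  set d := max 4 (Nat.clog 2 w)
  have hd : 4 ≤ d := le_max_left _ _
  have hΔd : Δ * d ≠ 0 := by positivity
  obtain ⟨q, hq, hlt, hle⟩ := Nat.exists_prime_lt_and_le_two_mul (Δ * d) hΔd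
  refine ⟨q, ⟨hq, d, ?_, hlt⟩, hle⟩
  have h1 : w ≤ 2 ^ d :=
    (Nat.le_pow_clog (by norm_num) w).trans
      (Nat.pow_le_pow_right (by norm_num) (le_max_right _ _))
  calc M ≤ Δ ^ 2 * w := hM
    _ ≤ Δ ^ d * 2 ^ d := Nat.mul_le_mul (Nat.pow_le_pow_right hΔ (by omega)) h1
    _ = (Δ * 2) ^ d := (mul_pow _ _ _).symm
    _ ≤ q ^ d := Nat.pow_le_pow_left (by nlinarith) d

/-- The least prime that is suitable for a round of color reduction. -/
noncomputable def reductionPrime (Δ M : ℕ) : ℕ := sInf {q | IsReductionPrime Δ M q}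

theorem reductionPrime_spec {Δ : ℕ} (hΔ : 1 ≤ Δ) (M : ℕ) :
    IsReductionPrime Δ M (reductionPrime Δ M) := by
  obtain ⟨q, hq, -⟩ := exists_isReductionPrime_le (w := M) hΔ
    (Nat.le_mul_of_pos_left M (by positivity))
  exact Nat.sInf_mem (s := {q | IsReductionPrime Δ M q}) ⟨q, hq⟩

/-- The size of the palette after `i` rounds of color reduction. -/
noncomputable def palette (Δ m i : ℕ) : ℕ := (fun M => reductionPrime Δ M ^ 2)^[i] m

theorem palette_zero (Δ m : ℕ) : palette Δ m 0 = m := rfl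

theorem palette_succ (Δ m i : ℕ) :
    palette Δ m (i + 1) = reductionPrime Δ (palette Δ m i) ^ 2 :=
  Function.iterate_succ_apply' _ _ _

theorem palette_le {Δ : ℕ} (hΔ : 1 ≤ Δ) (m i : ℕ) :
    palette Δ m i ≤ Δ ^ 2 * paletteFactor^[i] m := by
  induction i with
  | zero => exact Nat.le_mul_of_pos_left m (by positivity)
  | succ i ih =>
    rw [palette_succ, Function.iterate_succ_apply']
    obtain ⟨q, hq, hle⟩ := exists_isReductionPrime_le hΔ ih
    have h : reductionPrime Δ (palette Δ m i) ≤ q :=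
      Nat.sInf_le (s := {q | IsReductionPrime Δ _ q}) hq
    calc _ ≤ (2 * (Δ * max 4 (Nat.clog 2 (paletteFactor^[i] m)))) ^ 2 :=
          Nat.pow_le_pow_left (h.trans hle) 2
      _ = _ := by unfold paletteFactor; ring

/-- A bound uniform in the round, needed for the message size. -/
theorem palette_le_add {Δ : ℕ} (hΔ : 1 ≤ Δ) (m i : ℕ) :
    palette Δ m i ≤ Δ ^ 2 * (m + 324) := by
  refine (palette_le hΔ m i).trans (Nat.mul_le_mul_left _ ?_)
  have := iterate_paletteFactor_le m i
  omega

theorem exists_palette_le {Δ : ℕ} (hΔ : 1 ≤ Δ) (m : ℕ) : ∃ i, palette Δ m i ≤ 324 * Δ ^ 2 := by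
  refine ⟨m, (palette_le hΔ m m).trans ?_⟩
  have := iterate_paletteFactor_le m m
  rw [mul_comm]
  exact Nat.mul_le_mul_right _ (by omega)

/-- The number of rounds of color reduction until at most `target` colors are left. -/
noncomputable def reductionRounds (target Δ m : ℕ) : ℕ := sInf {i | palette Δ m i ≤ target}

theorem palette_reductionRounds_le {target Δ : ℕ} (hΔ : 1 ≤ Δ) (ht : 324 * Δ ^ 2 ≤ target)
    (m : ℕ) : palette Δ m (reductionRounds target Δ m) ≤ target := by
  obtain ⟨i, hi⟩ := exists_palette_le hΔ m
  exact Nat.sInf_mem (s := {i | palette Δ m i ≤ target}) ⟨i, hi.trans ht⟩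

theorem reductionRounds_le {target Δ m i : ℕ} (h : palette Δ m i ≤ target) :
    reductionRounds target Δ m ≤ i :=
  Nat.sInf_le (s := {i | palette Δ m i ≤ target}) h

/-- The number of rounds is computed from `m` and `Δ` alone; `n` and `c` enter only this analysis.
After `log* n` rounds the factor is at most `a`, and it then falls by at least one per round until
it is at most `324`. The second clause matters for `ε > 1`, where an additive constant cannot be
absorbed into `Δ ^ (1/2 - ε/2)`. -/
theorem exists_reductionRounds_le (c : ℕ) :
    ∃ a : ℕ, ∀ n m Δ target : ℕ, 1 ≤ Δ → m ≤ n ^ c → 324 * Δ ^ 2 ≤ target →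
      reductionRounds target Δ m ≤ logStar n + a ∧
      (a * Δ ^ 2 ≤ target → reductionRounds target Δ m ≤ logStar n) := by
  obtain ⟨a, ha⟩ := exists_iterate_paletteFactor_logStar_le c
  refine ⟨a, fun n m Δ target hΔ hm ht => ⟨?_, fun hat => ?_⟩⟩
  · refine reductionRounds_le ((palette_le hΔ m _).trans (le_trans ?_ ht))
    rw [mul_comm]
    refine Nat.mul_le_mul_right _ ?_
    rw [add_comm, Function.iterate_add_apply]
    have h1 := iterate_paletteFactor_le (paletteFactor^[logStar n] m) a
    have h2 := ha n m hm
    omega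
  · refine reductionRounds_le ((palette_le hΔ m _).trans (le_trans ?_ hat))
    rw [mul_comm]
    exact Nat.mul_le_mul_right _ (ha n m hm)

/-! ### Polynomial curves over a prime field -/

/-- The polynomial without constant term over `ZMod q` whose coefficients at `X, …, X ^ d` are the
`d` lowest digits of `i` in base `q`. -/
noncomputable def curvePoly (q d i : ℕ) : Polynomial (ZMod q) :=
  ∑ j ∈ Finset.range d, Polynomial.monomial (j + 1) ((i / q ^ j % q : ℕ) : ZMod q)

/-- The value of the `i`-th curve at the point `x`. -/
noncomputable def curve (q d i x : ℕ) : ZMod q := (curvePoly q d i).eval (x : ZMod q)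

theorem curvePoly_coeff_succ {q d i j : ℕ} (hj : j < d) :
    (curvePoly q d i).coeff (j + 1) = ((i / q ^ j % q : ℕ) : ZMod q) := by
  simp [curvePoly, Polynomial.finsetSum_coeff, Polynomial.coeff_monomial, hj]

theorem curvePoly_natDegree_le (q d i : ℕ) : (curvePoly q d i).natDegree ≤ d := by
  refine Polynomial.natDegree_sum_le_of_forall_le _ _ fun j hj => ?_
  exact (Polynomial.natDegree_monomial_le _).trans (Finset.mem_range.1 hj)

theorem eq_of_digits_eq {q : ℕ} (d : ℕ) {i j : ℕ} (hi : i < q ^ d) (hj : j < q ^ d)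
    (h : ∀ k < d, i / q ^ k % q = j / q ^ k % q) : i = j := by
  induction d generalizing i j with
  | zero => simp at hi hj; omega
  | succ d ih =>
    have h0 : i % q = j % q := by simpa using h 0 (by omega)
    have h1 : i / q = j / q := by
      refine ih (Nat.div_lt_of_lt_mul (by rwa [← pow_succ']))
        (Nat.div_lt_of_lt_mul (by rwa [← pow_succ'])) fun k hk => ?_
      have := h (k + 1) (by omega)
      rwa [pow_succ', ← Nat.div_div_eq_div_mul, ← Nat.div_div_eq_div_mul] at this
    rw [← Nat.div_add_mod i q, ← Nat.div_add_mod j q, h0, h1]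

/-- Two curves agree, up to a given shift, in at most `d` points. -/
theorem card_curve_eq_add_le {q : ℕ} (hq : q.Prime) {d i j : ℕ} (hi : i < q ^ d)
    (hj : j < q ^ d) (hij : i ≠ j) (a : ZMod q) :
    ((Finset.range q).filter fun x => curve q d i x = curve q d j x + a).card ≤ d := by
  have := Fact.mk hq
  set p := curvePoly q d i - curvePoly q d j - Polynomial.C a with hp
  -- The shift affects only the constant coefficient, and the digits sit in the coefficients of
  -- positive degree; hence the missing constant term.
  have hp0 : p ≠ 0 := by
    intro h0
    refine hij (eq_of_digits_eq d hi hj fun k hk => ?_)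
    have h1 : p.coeff (k + 1) = 0 := by rw [h0]; simp
    rw [hp, Polynomial.coeff_sub, Polynomial.coeff_sub, curvePoly_coeff_succ hk,
      curvePoly_coeff_succ hk, Polynomial.coeff_C_succ, sub_zero, sub_eq_zero,
      ZMod.natCast_eq_natCast_iff'] at h1
    simpa using h1
  have hdeg : p.natDegree ≤ d := by
    refine (Polynomial.natDegree_sub_le _ _).trans (max_le ?_ (by simp))
    exact (Polynomial.natDegree_sub_le _ _).trans
      (max_le (curvePoly_natDegree_le _ _ _) (curvePoly_natDegree_le _ _ _))
  classical
  calc _ ≤ p.roots.toFinset.card := by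
        refine Finset.card_le_card_of_injOn (fun x : ℕ => (x : ZMod q)) ?_ ?_
        · intro x hx
          have hx := (Finset.mem_filter.1 hx).2
          rw [Finset.mem_coe, Multiset.mem_toFinset, Polynomial.mem_roots hp0,
            Polynomial.IsRoot.def, hp, Polynomial.eval_sub, Polynomial.eval_sub, Polynomial.eval_C]
          simp only [curve] at hx
          rw [hx]; ring
        · intro x hx y hy hxy
          have hx := Finset.mem_range.1 (Finset.mem_filter.1 hx).1
          have hy := Finset.mem_range.1 (Finset.mem_filter.1 hy).1
          have hxy : (x : ZMod q) = y := hxy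
          rwa [ZMod.natCast_eq_natCast_iff', Nat.mod_eq_of_lt hx, Nat.mod_eq_of_lt hy] at hxy
    _ ≤ p.roots.card := Multiset.toFinset_card_le _
    _ ≤ d := (Polynomial.card_roots' p).trans hdeg

theorem card_curve_eq_le {q : ℕ} (hq : q.Prime) {d i j : ℕ} (hi : i < q ^ d)
    (hj : j < q ^ d) (hij : i ≠ j) :
    ((Finset.range q).filter fun x => curve q d i x = curve q d j x).card ≤ d := by
  simpa using card_curve_eq_add_le hq hi hj hij 0

theorem curve_zero (q d x : ℕ) : curve q d 0 x = 0 := by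
  simp [curve, curvePoly]

/-- A curve with nonzero index takes each value in at most `d` points. -/
theorem card_curve_eq_const_le {q : ℕ} (hq : q.Prime) {d i : ℕ} (hi : i < q ^ d) (h0 : i ≠ 0)
    (a : ZMod q) : ((Finset.range q).filter fun x => curve q d i x = a).card ≤ d := by
  simpa [curve_zero] using
    card_curve_eq_add_le hq hi (Nat.pow_pos hq.pos) h0 a

/-- A point avoiding finitely many sets that cover less than the field. -/
theorem exists_lt_forall_not {q k b : ℕ} (bad : Fin k → ℕ → Prop)
    [∀ i, DecidablePred (bad i)] (hb : ∀ i, ((Finset.range q).filter (bad i)).card ≤ b)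
    (hq : k * b < q) : ∃ y < q, ∀ i, ¬ bad i y := by
  by_contra! h
  have hsub : Finset.range q ⊆
      Finset.univ.biUnion fun i => (Finset.range q).filter (bad i) := by
    intro y hy
    obtain ⟨i, hi⟩ := h y (Finset.mem_range.1 hy)
    exact Finset.mem_biUnion.2 ⟨i, Finset.mem_univ i, Finset.mem_filter.2 ⟨hy, hi⟩⟩
  have h1 := Finset.card_le_card hsub
  have h2 := Finset.card_biUnion_le_card_mul Finset.univ
    (fun i => (Finset.range q).filter (bad i)) b fun i _ => hb i
  simp at h1 h2
  omega

theorem mul_add_val_injective {q : ℕ} (hq : q.Prime) {x y : ℕ} {a b : ZMod q}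
    (h : x * q + a.val = y * q + b.val) : x = y ∧ a = b := by
  have := Fact.mk hq
  have ha := ZMod.val_lt a
  have hb := ZMod.val_lt b
  have hx : x = y := by
    have h1 := congrArg (· / q) h
    simpa [Nat.mul_add_div, mul_comm, Nat.div_eq_of_lt ha, Nat.div_eq_of_lt hb, hq.pos] using h1
  subst hx
  exact ⟨rfl, ZMod.val_injective q (by omega)⟩

theorem mul_add_val_lt_sq {q : ℕ} (hq : q.Prime) {x : ℕ} (hx : x < q) (a : ZMod q) :
    x * q + a.val < q ^ 2 := by
  have := Fact.mk hq
  have ha := ZMod.val_lt a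
  nlinarith

/-! ### The local steps of the algorithm -/

/-- The part of the state of a node that it broadcasts in every round. -/
structure Label where
  /-- the current color -/
  col : ℕ
  /-- the point at which the node joined its class -/
  cls : Option ℕ
  /-- the shift of the curve of the node -/
  shift : Option ℕ
  /-- the point of the shifted curve that the node has chosen as its final color -/
  pos : Option ℕ

/-- The label of a node that has nothing but a color. -/
def Label.ofColor (i : ℕ) : Label := ⟨i, none, none, none⟩

/-- The class of a node: the value of its curve at the point where it joined. -/
noncomputable def Label.classIndex (Q d : ℕ) (s : Label) : ℕ :=
  (curve Q d (s.col + 1) (s.cls.getD 0)).val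

/-- The shifted curve of a node. -/
noncomputable def Label.shifted (q d : ℕ) (s : Label) (z : ℕ) : ZMod q :=
  curve q d s.col z + (s.shift.getD 0 : ℕ)

/-- One round of color reduction: choose a point of the own curve on none of the curves of the
neighbors. -/
noncomputable def reduceStep (q d : ℕ) (s : Label) (N : List Label) : Label :=
  let y := sInf {y | y < q ∧ ∀ u ∈ N, curve q d s.col y ≠ curve q d u.col y}
  { s with col := y * q + (curve q d s.col y).val }

/-- Round `j` of the formation of classes: a node joins the class given by the value of its
curve at `j` if at most `β` neighbors are in that class or try to join it. -/
noncomputable def classStep (Q d β j : ℕ) (s : Label) (N : List Label) : Label :=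
  if s.cls = none ∧ N.countP (fun u => curve Q d (u.col + 1) (u.cls.getD j) =
      curve Q d (s.col + 1) j) ≤ β then
    { s with cls := some j }
  else s

open Classical in
/-- The points of the own curve, shifted by `a`, that are final colors of neighbors. -/
noncomputable def takenPoints (q d : ℕ) (s : Label) (N : List Label) (a : ℕ) : Finset ℕ :=
  (Finset.range q).filter fun z =>
    ∃ u ∈ N, u.pos = some z ∧ u.shifted q d z = curve q d s.col z + (a : ZMod q)

/-- Round `j` of the final coloring. In round `2 * i` the nodes of class `i` choose a shift of their
curve that hits few final colors of neighbors; in round `2 * i + 1` they choose a point of their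
curve that is neither the final color of a neighbor nor on the curve of a neighbor
in the same class that joined no later. -/
noncomputable def finalStep (Δ Q q d j : ℕ) (s : Label) (N : List Label) : Label :=
  if s.classIndex Q d = j / 2 then
    if j % 2 = 0 then
      { s with shift := some (sInf {a | a < q ∧ q * (takenPoints q d s N a).card ≤ Δ}) }
    else
      { s with pos := some (sInf {z | z < q ∧ ∀ u ∈ N,
          (u.pos = some z ∨ (u.classIndex Q d = s.classIndex Q d ∧ u.cls.getD 0 ≤ s.cls.getD 0)) →
            u.shifted q d z ≠ s.shifted q d z}) }
  else s

theorem countP_ofFn {α : Type*} {k : ℕ} (f : Fin k → α) (p : α → Prop) [DecidablePred p] :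
    (List.ofFn f).countP p = (Finset.univ.filter fun i => p (f i)).card := by
  induction k with
  | zero => simp
  | succ k ih =>
    rw [List.ofFn_succ, List.countP_cons, ih, Fin.card_filter_univ_succ]
    by_cases h : p (f 0) <;> simp [h]

theorem sInf_lt_of_forall_lt {q : ℕ} (hq : 0 < q) {s : Set ℕ} (hs : ∀ y ∈ s, y < q) :
    sInf s < q := by
  rcases s.eq_empty_or_nonempty with rfl | h
  · simpa
  · exact hs _ (Nat.sInf_mem h)

/-! ### Color reduction -/

section Stages

variable {V : Type*} {deg : V → ℕ} {nb : ∀ v, Fin (deg v) → V} {Δ : ℕ}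

/-- The neighbors exclude at most `Δ * d < q` points, so the infimum is attained. Equal new colors
would mean equal points and values, putting a neighbor's curve through the chosen point. -/
theorem reduceStep_proper {q d M : ℕ} (hq : q.Prime) (hM : M ≤ q ^ d) (hd : Δ * d < q)
    (hdeg : ∀ v, deg v ≤ Δ) {σ : V → Label}
    (hσ : ∀ v, (σ v).col < M) (hproper : ∀ v i, (σ (nb v i)).col ≠ (σ v).col) (v : V)
    (i : Fin (deg v)) :
    (reduceStep q d (σ (nb v i)) (List.ofFn fun j => σ (nb (nb v i) j))).col ≠
      (reduceStep q d (σ v) (List.ofFn fun j => σ (nb v j))).col := by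
  have key : ∀ v, sInf {y | y < q ∧ ∀ u ∈ List.ofFn fun j => σ (nb v j),
      curve q d (σ v).col y ≠ curve q d u.col y} ∈ {y | y < q ∧
      ∀ u ∈ List.ofFn fun j => σ (nb v j), curve q d (σ v).col y ≠ curve q d u.col y} := by
    intro v
    apply Nat.sInf_mem
    obtain ⟨y, hy, h⟩ := exists_lt_forall_not (q := q) (b := d)
      (fun (i : Fin (deg v)) y => curve q d (σ v).col y = curve q d (σ (nb v i)).col y)
      (fun i => card_curve_eq_le hq ((hσ _).trans_le hM) ((hσ _).trans_le hM)
        (hproper v i).symm) ((Nat.mul_le_mul_right d (hdeg v)).trans_lt hd)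
    refine ⟨y, hy, fun u hu => ?_⟩
    obtain ⟨j, rfl⟩ := List.mem_ofFn.1 hu
    exact h j
  intro h
  obtain ⟨h1, h2⟩ := mul_add_val_injective hq h
  rw [h1] at h2
  exact (key v).2 _ (List.mem_ofFn.2 ⟨i, rfl⟩) h2.symm

/-! ### Formation of classes -/

/-- A neighbor conflicts with a node in two ways: its own class is already fixed and the node's
curve takes that value, or it is undecided and both curves have the same value at `j`. Each happens
for at most `d` values of `j`. A node that never joins would see at least `β + 1` conflicts in each
of the `Q` rounds, too many in total. -/
theorem classes_of_recursion {Q d β : ℕ} (hQ : Q.Prime) (hdeg : ∀ v, deg v ≤ Δ)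
    (hβ : 2 * d * Δ < Q * (β + 1)) {ψ : V → ℕ} (hψ : ∀ v, ψ v + 1 < Q ^ d)
    (hproper : ∀ v i, ψ (nb v i) ≠ ψ v) {c : ℕ → V → Option ℕ} (h0 : ∀ v, c 0 v = none)
    (hc : ∀ j < Q, ∀ v, c (j + 1) v = if c j v = none ∧ (Finset.univ.filter fun i =>
      curve Q d (ψ (nb v i) + 1) ((c j (nb v i)).getD j) = curve Q d (ψ v + 1) j).card ≤ β
      then some j else c j v) :
    ∃ x : V → ℕ, (∀ v, x v < Q) ∧ (∀ v, c Q v = some (x v)) ∧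
      ∀ v, (Finset.univ.filter fun i => curve Q d (ψ (nb v i) + 1) (x (nb v i)) =
        curve Q d (ψ v + 1) (x v) ∧ x (nb v i) ≤ x v).card ≤ β := by
  have hmono : ∀ j k, j ≤ k → k ≤ Q → ∀ v y, c j v = some y → c k v = some y := by
    intro j k hjk
    induction k, hjk using Nat.le_induction with
    | base => exact fun _ _ _ h => h
    | succ k _ ih =>
      intro hk v y h
      rw [hc k (by omega), ih (by omega) v y h]
      simp
  have hjoin : ∀ j ≤ Q, ∀ v y, c j v = some y → y < j ∧ c y v = none ∧
      (Finset.univ.filter fun i => curve Q d (ψ (nb v i) + 1) ((c y (nb v i)).getD y) =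
        curve Q d (ψ v + 1) y).card ≤ β := by
    intro j
    induction j with
    | zero => intro _ v y h; simp [h0] at h
    | succ j ih =>
      intro hj v y h
      rw [hc j (by omega)] at h
      split_ifs at h with hif
      · obtain rfl : j = y := by simpa using h
        exact ⟨by omega, hif⟩
      · obtain ⟨h1, h2⟩ := ih (by omega) v y h
        exact ⟨by omega, h2⟩
  have hex : ∀ v, ∃ y, c Q v = some y := by
    intro v
    by_contra! hne
    have hnone : ∀ j ≤ Q, c j v = none := by
      intro j hj
      by_contra h
      obtain ⟨y, hy⟩ := Option.ne_none_iff_exists'.1 h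
      exact hne y (hmono j Q hj le_rfl v y hy)
    have hlarge : ∀ j ∈ Finset.range Q, β + 1 ≤ (Finset.univ.filter fun i =>
        curve Q d (ψ (nb v i) + 1) ((c j (nb v i)).getD j) = curve Q d (ψ v + 1) j).card := by
      intro j hj
      have hj := Finset.mem_range.1 hj
      by_contra! hlt
      have := hc j hj v
      rw [if_pos ⟨hnone j hj.le, by omega⟩] at this
      exact hne j (hmono (j + 1) Q hj le_rfl v j this)
    have hsmall : ∀ i : Fin (deg v), ((Finset.range Q).filter fun j =>
        curve Q d (ψ (nb v i) + 1) ((c j (nb v i)).getD j) = curve Q d (ψ v + 1) j).card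
          ≤ 2 * d := by
      intro i
      set u := nb v i with hu
      have hsub : ((Finset.range Q).filter fun j =>
          curve Q d (ψ u + 1) ((c j u).getD j) = curve Q d (ψ v + 1) j) ⊆
          ((Finset.range Q).filter fun j => curve Q d (ψ u + 1) j = curve Q d (ψ v + 1) j) ∪
          ((Finset.range Q).filter fun j =>
            curve Q d (ψ v + 1) j = curve Q d (ψ u + 1) ((c Q u).getD 0)) := by
        intro j hj
        obtain ⟨hjQ, hj⟩ := Finset.mem_filter.1 hj
        rw [Finset.mem_union, Finset.mem_filter, Finset.mem_filter]
        rcases hcu : c j u with _ | y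
        · left
          rw [hcu] at hj
          exact ⟨hjQ, hj⟩
        · right
          rw [hcu] at hj
          rw [hmono j Q (Finset.mem_range.1 hjQ).le le_rfl u y hcu]
          exact ⟨hjQ, hj.symm⟩
      have h1 := card_curve_eq_le hQ (hψ u) (hψ v) (by have := hproper v i; rw [← hu] at this; omega)
      -- The index `ψ v + 1` is nonzero; index `0` would give a constant curve, which could conflict
      -- in every round.
      have h2 := card_curve_eq_const_le hQ (hψ v) (by omega)
        (curve Q d (ψ u + 1) ((c Q u).getD 0))
      have h3 := (Finset.card_le_card hsub).trans (Finset.card_union_le _ _)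
      omega
    have hcount := Finset.sum_card_bipartiteAbove_eq_sum_card_bipartiteBelow
      (s := Finset.range Q) (t := (Finset.univ : Finset (Fin (deg v))))
      (fun j i => curve Q d (ψ (nb v i) + 1) ((c j (nb v i)).getD j) = curve Q d (ψ v + 1) j)
    have hl := Finset.sum_le_sum hlarge
    have hs := Finset.sum_le_sum fun i (_ : i ∈ (Finset.univ : Finset (Fin (deg v)))) => hsmall i
    simp only [Finset.sum_const, Finset.card_range, Finset.card_univ, Fintype.card_fin,
      smul_eq_mul] at hl hs
    simp only [Finset.bipartiteAbove, Finset.bipartiteBelow] at hcount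
    have := Nat.mul_le_mul_right (2 * d) (hdeg v)
    rw [mul_comm Δ] at this
    omega
  choose x hx using hex
  refine ⟨x, fun v => (hjoin Q le_rfl v _ (hx v)).1, hx, fun v => ?_⟩
  obtain ⟨hxQ, -, hcard⟩ := hjoin Q le_rfl v _ (hx v)
  refine (Finset.card_le_card fun i hi => ?_).trans hcard
  obtain ⟨hi1, hi2⟩ := (Finset.mem_filter.1 hi).2
  refine Finset.mem_filter.2 ⟨Finset.mem_univ i, ?_⟩
  -- A neighbor still undecided when `v` joins, yet joining no later, joins in the same round. Its
  -- attempted class, supplied by `getD`, was therefore counted.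
  rcases hcu : c (x v) (nb v i) with _ | y
  · have hle : x (nb v i) = x v := by
      refine le_antisymm hi2 ?_
      by_contra! hlt
      obtain ⟨_, hn, hb⟩ := hjoin Q le_rfl _ _ (hx (nb v i))
      have h1 := hc (x (nb v i)) (by omega) (nb v i)
      rw [if_pos ⟨hn, hb⟩] at h1
      rw [hmono _ (x v) hlt hxQ.le _ _ h1] at hcu
      exact absurd hcu (by simp)
    rw [hle] at hi1
    exact hi1
  · have := hmono (x v) Q hxQ.le le_rfl _ _ hcu
    rw [hx] at this
    rw [← this]
    exact hi1

theorem classes_of_classStep {Q d β : ℕ} (hQ : Q.Prime) (hdeg : ∀ v, deg v ≤ Δ)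
    (hβ : 2 * d * Δ < Q * (β + 1)) {ψ : V → ℕ} (hψ : ∀ v, ψ v + 1 < Q ^ d)
    (hproper : ∀ v i, ψ (nb v i) ≠ ψ v) {τ : ℕ → V → Label}
    (h0 : ∀ v, τ 0 v = Label.ofColor (ψ v))
    (hτ : ∀ j < Q, ∀ v, τ (j + 1) v =
      classStep Q d β j (τ j v) (List.ofFn fun i => τ j (nb v i))) :
    ∃ x : V → ℕ, (∀ v, x v < Q) ∧ (∀ v, τ Q v = ⟨ψ v, some (x v), none, none⟩) ∧
      ∀ v, (Finset.univ.filter fun i => curve Q d (ψ (nb v i) + 1) (x (nb v i)) =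
        curve Q d (ψ v + 1) (x v) ∧ x (nb v i) ≤ x v).card ≤ β := by
  have hform : ∀ j ≤ Q, ∀ v, τ j v = ⟨ψ v, (τ j v).cls, none, none⟩ := by
    intro j
    induction j with
    | zero => intro _ v; rw [h0]; rfl
    | succ j ih =>
      intro hj v
      have := ih (by omega) v
      rw [hτ j (by omega) v]
      unfold classStep
      split_ifs
      · rw [this]
      · exact this
  obtain ⟨x, hxQ, hx, hcard⟩ := classes_of_recursion (c := fun j v => (τ j v).cls) hQ hdeg hβ hψ
    hproper (fun v => by rw [h0]; rfl) (by
      intro j hj v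
      have hcol : ∀ v, (τ j v).col = ψ v := fun v => by rw [hform j hj.le v]
      simp only [hτ j hj v, classStep]
      rw [countP_ofFn]
      simp only [hcol]
      split_ifs <;> rfl)
  refine ⟨x, hxQ, fun v => ?_, hcard⟩
  rw [hform Q le_rfl v, hx v]

end Stages

/-! ### The final coloring -/

theorem mem_takenPoints_ofFn {q d k : ℕ} {s : Label} {l : Fin k → Label} {a z : ℕ} :
    z ∈ takenPoints q d s (List.ofFn l) a ↔ z < q ∧ ∃ i, (l i).pos = some z ∧
      (l i).shifted q d z = curve q d s.col z + (a : ZMod q) := by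
  classical
  rw [takenPoints, Finset.mem_filter, Finset.mem_range]
  refine and_congr_right fun _ => ⟨?_, ?_⟩
  · rintro ⟨u, hu, h⟩
    obtain ⟨i, rfl⟩ := List.mem_ofFn.1 hu
    exact ⟨i, h⟩
  · rintro ⟨i, h⟩
    exact ⟨l i, List.mem_ofFn.2 ⟨i, rfl⟩, h⟩

/-- By averaging, some shift of a curve hits few final colors of neighbors. -/
theorem exists_shift_card_takenPoints_le {q d k Δ : ℕ} (hq : q.Prime) (s : Label)
    (l : Fin k → Label) (hk : k ≤ Δ) :
    ∃ a < q, q * (takenPoints q d s (List.ofFn l) a).card ≤ Δ := by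
  classical
  -- Each neighbor accounts for at most one pair of shift and point: its final color fixes the
  -- point, and the equation there fixes the shift.
  have hsum : ∑ a ∈ Finset.range q, (takenPoints q d s (List.ofFn l) a).card ≤ k := by
    rw [← Finset.card_sigma]
    have := Finset.card_le_card_of_forall_subsingleton
      (s := (Finset.range q).sigma fun a => takenPoints q d s (List.ofFn l) a)
      (t := (Finset.univ : Finset (Fin k)))
      (fun p i => (l i).pos = some p.2 ∧
        (l i).shifted q d p.2 = curve q d s.col p.2 + (p.1 : ZMod q))
      (by
        rintro ⟨a, z⟩ h
        obtain ⟨-, i, hi⟩ := mem_takenPoints_ofFn.1 (Finset.mem_sigma.1 h).2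
        exact ⟨i, Finset.mem_univ i, hi⟩)
      (by
        rintro i - ⟨a, z⟩ ⟨h1, h2, h3⟩ ⟨b, y⟩ ⟨g1, g2, g3⟩
        have ha := Finset.mem_range.1 (Finset.mem_sigma.1 h1).1
        have hb := Finset.mem_range.1 (Finset.mem_sigma.1 g1).1
        simp only at h2 h3 g2 g3 ha hb
        obtain rfl : z = y := by simpa [h2] using g2
        rw [h3, add_right_inj, ZMod.natCast_eq_natCast_iff', Nat.mod_eq_of_lt ha,
          Nat.mod_eq_of_lt hb] at g3
        subst g3
        rfl)
    simpa using this
  by_contra! h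
  have h1 := Finset.sum_le_sum fun a (ha : a ∈ Finset.range q) =>
    Nat.succ_le_of_lt (h a (Finset.mem_range.1 ha))
  rw [← Finset.mul_sum, Finset.sum_const, Finset.card_range, smul_eq_mul] at h1
  have := Nat.le_of_mul_le_mul_left h1 hq.pos
  omega

section Stages

variable {V : Type*} {deg : V → ℕ} {nb : ∀ v, Fin (deg v) → V} {Δ : ℕ}

/-- A node of class `κ v` changes its label only in rounds `2 * κ v` and `2 * κ v + 1`. On every
edge at least one end avoids the other: the end in the higher class avoids a final color, and within
a class an end that joined no earlier avoids the other's whole shifted curve. -/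
theorem coloring_of_finalStep {Q q d β : ℕ} (hQ : Q.Prime) (hq : q.Prime)
    (hdeg : ∀ v, deg v ≤ Δ) (hsymm : ∀ v i, ∃ j, nb (nb v i) j = v) (hβ : 2 * β * d < q)
    (hΔ : 2 * Δ < q ^ 2) {ψ x : V → ℕ} (hψ : ∀ v, ψ v < q ^ d)
    (hproper : ∀ v i, ψ (nb v i) ≠ ψ v)
    (hcard : ∀ v, (Finset.univ.filter fun i => curve Q d (ψ (nb v i) + 1) (x (nb v i)) =
        curve Q d (ψ v + 1) (x v) ∧ x (nb v i) ≤ x v).card ≤ β)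
    {τ : ℕ → V → Label} (h0 : ∀ v, τ 0 v = ⟨ψ v, some (x v), none, none⟩)
    (hτ : ∀ j < 2 * Q, ∀ v, τ (j + 1) v =
      finalStep Δ Q q d j (τ j v) (List.ofFn fun i => τ j (nb v i))) :
    ∃ a z : V → ℕ, (∀ v, z v < q) ∧
      (∀ v, τ (2 * Q) v = ⟨ψ v, some (x v), some (a v), some (z v)⟩) ∧
      ∀ v i, z (nb v i) = z v →
        curve q d (ψ (nb v i)) (z v) + (a (nb v i) : ZMod q) ≠
          curve q d (ψ v) (z v) + (a v : ZMod q) := by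
  have : Fact Q.Prime := ⟨hQ⟩
  set κ : V → ℕ := fun v => (curve Q d (ψ v + 1) (x v)).val with hκ
  have hκQ : ∀ v, κ v < Q := fun v => ZMod.val_lt _
  have hcc : ∀ j ≤ 2 * Q, ∀ v, (τ j v).col = ψ v ∧ (τ j v).cls = some (x v) := by
    intro j
    induction j with
    | zero => intro _ v; rw [h0]; exact ⟨rfl, rfl⟩
    | succ j ih =>
      intro hj v
      rw [hτ j (by omega) v]
      unfold finalStep
      split_ifs <;> exact ih (by omega) v
  have hclass : ∀ j ≤ 2 * Q, ∀ v, (τ j v).classIndex Q d = κ v := by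
    intro j hj v
    rw [Label.classIndex, (hcc j hj v).1, (hcc j hj v).2]
    rfl
  have hstay : ∀ j < 2 * Q, ∀ v, j / 2 ≠ κ v → τ (j + 1) v = τ j v := by
    intro j hj v h
    rw [hτ j hj v, finalStep, if_neg]
    rw [hclass j hj.le v]
    exact h.symm
  have hbefore : ∀ v, ∀ j ≤ 2 * κ v, τ j v = τ 0 v := by
    intro v j
    induction j with
    | zero => intro _; rfl
    | succ j ih =>
      intro hj
      have := hκQ v
      rw [hstay j (by omega) v (by omega), ih (by omega)]
  have hafter : ∀ v j, 2 * κ v + 2 ≤ j → j ≤ 2 * Q → τ j v = τ (2 * κ v + 2) v := by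
    intro v j hj
    induction j, hj using Nat.le_induction with
    | base => exact fun _ => rfl
    | succ j hj ih =>
      intro hjQ
      rw [hstay j (by omega) v (by omega), ih (by omega)]
  have hshift : ∀ v, ∃ a, q * (takenPoints q d (τ (2 * κ v) v)
      (List.ofFn fun i => τ (2 * κ v) (nb v i)) a).card ≤ Δ ∧
      τ (2 * κ v + 1) v = ⟨ψ v, some (x v), some a, none⟩ := by
    intro v
    have := hκQ v
    refine ⟨sInf {a | a < q ∧ q * (takenPoints q d (τ (2 * κ v) v)
      (List.ofFn fun i => τ (2 * κ v) (nb v i)) a).card ≤ Δ}, ?_, ?_⟩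
    · exact (Nat.sInf_mem (s := {a | a < q ∧ q * (takenPoints q d (τ (2 * κ v) v)
        (List.ofFn fun i => τ (2 * κ v) (nb v i)) a).card ≤ Δ})
        (exists_shift_card_takenPoints_le hq _ _ (hdeg v))).2
    · rw [hτ _ (by omega) v, finalStep, if_pos (by rw [hclass _ (by omega)]; omega),
        if_pos (by omega)]
      simp only [hbefore v _ le_rfl, h0]
  choose a hataken ha using hshift
  have hposlt : ∀ v, ∀ j ≤ 2 * Q, ∀ y, (τ j v).pos = some y → 2 * κ v + 2 ≤ j := by
    intro v j hj y hy
    by_contra! hlt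
    rcases Nat.lt_or_ge (2 * κ v) j with h | h
    · obtain rfl : j = 2 * κ v + 1 := by omega
      rw [ha] at hy
      simp at hy
    · rw [hbefore v j h, h0] at hy
      simp at hy
  have hpos : ∀ v, ∃ z < q, τ (2 * κ v + 2) v = ⟨ψ v, some (x v), some (a v), some z⟩ ∧
      ∀ i, ((τ (2 * κ v + 1) (nb v i)).pos = some z ∨
        (κ (nb v i) = κ v ∧ x (nb v i) ≤ x v)) →
        (τ (2 * κ v + 1) (nb v i)).shifted q d z ≠
          curve q d (ψ v) z + (a v : ZMod q) := by
    intro v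
    have hv := hκQ v
    set S : Set ℕ := {z | z < q ∧ ∀ u ∈ List.ofFn fun i => τ (2 * κ v + 1) (nb v i),
      (u.pos = some z ∨ (u.classIndex Q d = (τ (2 * κ v + 1) v).classIndex Q d ∧
        u.cls.getD 0 ≤ (τ (2 * κ v + 1) v).cls.getD 0)) →
          u.shifted q d z ≠ (τ (2 * κ v + 1) v).shifted q d z} with hS
    have hsv : ∀ z, (τ (2 * κ v + 1) v).shifted q d z = curve q d (ψ v) z + (a v : ZMod q) := by
      intro z
      rw [ha, Label.shifted]
      rfl
    have hiff : ∀ z, z ∈ S ↔ z < q ∧ ∀ i, ((τ (2 * κ v + 1) (nb v i)).pos = some z ∨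
        (κ (nb v i) = κ v ∧ x (nb v i) ≤ x v)) →
        (τ (2 * κ v + 1) (nb v i)).shifted q d z ≠ curve q d (ψ v) z + (a v : ZMod q) := by
      intro z
      simp only [hS, Set.mem_ofPred_eq, List.forall_mem_ofFn_iff, hsv,
        hclass (2 * κ v + 1) (by omega), (hcc (2 * κ v + 1) (by omega) _).2, Option.getD_some]
    have hne : S.Nonempty := by
      classical
      by_contra hemp
      set T := takenPoints q d (τ (2 * κ v) v) (List.ofFn fun i => τ (2 * κ v) (nb v i)) (a v)
        with hT
      set O := Finset.univ.filter fun i => curve Q d (ψ (nb v i) + 1) (x (nb v i)) =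
        curve Q d (ψ v + 1) (x v) ∧ x (nb v i) ≤ x v with hO
      have hsub : Finset.range q ⊆ T ∪ O.biUnion fun i => (Finset.range q).filter fun z =>
          (τ (2 * κ v + 1) (nb v i)).shifted q d z = curve q d (ψ v) z + (a v : ZMod q) := by
        intro z hz
        have hzS : z ∉ S := fun h => hemp ⟨z, h⟩
        rw [hiff] at hzS
        push Not at hzS
        obtain ⟨i, hi, heq⟩ := hzS (Finset.mem_range.1 hz)
        rw [Finset.mem_union]
        rcases hi with hi | hi
        -- A neighbor that already has a final color was finished before round `2 * κ v`, so the
        -- point was counted when the shift was chosen.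
        · left
          have h1 := hposlt _ _ (by omega) _ hi
          have h2 : τ (2 * κ v) (nb v i) = τ (2 * κ v + 1) (nb v i) := by
            rw [hafter (nb v i) (2 * κ v) (by omega) (by omega), hafter (nb v i) _ h1 (by omega)]
          refine mem_takenPoints_ofFn.2 ⟨Finset.mem_range.1 hz, i, by rw [h2]; exact hi, ?_⟩
          rw [h2, heq, hbefore v _ le_rfl, h0]
        · right
          refine Finset.mem_biUnion.2 ⟨i, Finset.mem_filter.2 ⟨Finset.mem_univ i, ?_, hi.2⟩,
            Finset.mem_filter.2 ⟨hz, heq⟩⟩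
          exact ZMod.val_injective Q hi.1
      have hcurves : ∀ i ∈ O, ((Finset.range q).filter fun z =>
          (τ (2 * κ v + 1) (nb v i)).shifted q d z =
            curve q d (ψ v) z + (a v : ZMod q)).card ≤ d := by
        intro i _
        refine le_trans (Finset.card_le_card ?_) (card_curve_eq_add_le hq (hψ (nb v i)) (hψ v)
          (hproper v i) ((a v : ZMod q) - ((τ (2 * κ v + 1) (nb v i)).shift.getD 0 : ℕ)))
        intro z hz
        obtain ⟨hz1, hz2⟩ := Finset.mem_filter.1 hz
        refine Finset.mem_filter.2 ⟨hz1, ?_⟩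
        rw [Label.shifted, (hcc _ (by omega) _).1] at hz2
        rw [eq_sub_of_add_eq hz2]
        ring
      have h1 := (Finset.card_le_card hsub).trans (Finset.card_union_le _ _)
      have h2 := Finset.card_biUnion_le_card_mul O _ d hcurves
      have h3 : O.card * d ≤ β * d := Nat.mul_le_mul_right d (hcard v)
      have h4 : q * T.card ≤ Δ := hataken v
      have h5 : 2 * T.card < q := by
        refine Nat.lt_of_mul_lt_mul_left (a := q) ?_
        calc q * (2 * T.card) = 2 * (q * T.card) := by ring
          _ ≤ 2 * Δ := by omega
          _ < q * q := by rw [← sq]; exact hΔ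
      rw [Finset.card_range] at h1
      rw [mul_assoc] at hβ
      omega
    have hmem := (hiff _).1 (Nat.sInf_mem hne)
    refine ⟨sInf S, hmem.1, ?_, hmem.2⟩
    rw [hτ (2 * κ v + 1) (by omega) v, finalStep,
      if_pos (by rw [hclass _ (by omega)]; omega), if_neg (by omega), ← hS]
    simp only [ha]
  choose z hzq hz hzspec using hpos
  refine ⟨a, z, hzq, fun v => ?_, ?_⟩
  · have := hκQ v
    rw [hafter v _ (by omega) le_rfl, hz]
  have key : ∀ v i, (κ (nb v i) < κ v ∨ (κ (nb v i) = κ v ∧ x (nb v i) ≤ x v)) →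
      z (nb v i) = z v → curve q d (ψ (nb v i)) (z v) + (a (nb v i) : ZMod q) ≠
          curve q d (ψ v) (z v) + (a v : ZMod q) := by
    intro v i h hzz
    have hv := hκQ v
    have hspec := hzspec v i
    rcases h with h | h
    · rw [hafter (nb v i) _ (by omega) (by omega), hz, hzz] at hspec
      exact hspec (Or.inl rfl)
    · have hu := ha (nb v i)
      rw [h.1] at hu
      rw [hu] at hspec
      exact hspec (Or.inr h)
  intro v i hzz
  by_cases h : κ (nb v i) < κ v ∨ (κ (nb v i) = κ v ∧ x (nb v i) ≤ x v)
  · exact key v i h hzz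
  · obtain ⟨j, hj⟩ := hsymm v i
    have := key (nb v i) j (by rw [hj]; omega) (by rw [hj, hzz])
    rw [hj, hzz] at this
    exact this.symm

end Stages

/-! ### The algorithm -/

/-! ### Encoding of labels as bit strings -/

theorem Nat.bits_injective : Function.Injective Nat.bits := by
  intro m n h
  refine Nat.eq_of_testBit_eq fun i => ?_
  rw [Nat.testBit_eq_inth, Nat.testBit_eq_inth, h]

/-- The number that encodes a label. -/
def Label.code (s : Label) : ℕ := Encodable.encode (s.col, s.cls, s.shift, s.pos)

theorem Label.code_injective : Function.Injective Label.code := by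
  rintro ⟨a, b, c, d⟩ ⟨a', b', c', d'⟩ h
  have := Encodable.encode_injective h
  simp only [Prod.mk.injEq] at this
  obtain ⟨rfl, rfl, rfl, rfl⟩ := this
  rfl

/-- The bit string that encodes a label. -/
def Label.toBits (s : Label) : List Bool := s.code.bits

theorem Label.toBits_injective : Function.Injective Label.toBits :=
  Nat.bits_injective.comp Label.code_injective

instance : Nonempty Label := ⟨Label.ofColor 0⟩

/-- All entries of a label are less than `M`. -/
def Label.Bounded (M : ℕ) (s : Label) : Prop :=
  s.col < M ∧ (∀ y ∈ s.cls, y < M) ∧ (∀ y ∈ s.shift, y < M) ∧ ∀ y ∈ s.pos, y < M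

theorem Nat.pair_lt_sq {a b k : ℕ} (ha : a < k) (hb : b < k) : Nat.pair a b < k ^ 2 :=
  (Nat.pair_lt_max_add_one_sq a b).trans_le (Nat.pow_le_pow_left (by omega) 2)

theorem encode_option_lt {M : ℕ} {o : Option ℕ} (h : ∀ y ∈ o, y < M) :
    Encodable.encode o < M + 1 := by
  rcases o with _ | y
  · simp
  · simpa using h y rfl

/-- Three nested pairings each square the bound, whence the exponent 8; `M + 1` leaves room for
`none`. -/
theorem Label.Bounded.code_lt {M : ℕ} {s : Label} (h : s.Bounded M) : s.code < (M + 1) ^ 8 := by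
  obtain ⟨h1, h2, h3, h4⟩ := h
  have e2 := encode_option_lt h2
  have e3 := encode_option_lt h3
  have e4 := encode_option_lt h4
  have hle : ∀ k : ℕ, k ≠ 0 → M + 1 ≤ (M + 1) ^ k := fun k hk => Nat.le_self_pow hk _
  have f1 := Nat.pair_lt_sq e3 e4
  have f2 := Nat.pair_lt_sq (e2.trans_le (hle 2 (by norm_num))) f1
  rw [← pow_mul] at f2
  have f3 := Nat.pair_lt_sq ((h1.trans (Nat.lt_succ_self M)).trans_le (hle 4 (by norm_num))) f2
  rw [← pow_mul] at f3
  exact f3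

theorem reduceStep_col_lt {q d : ℕ} (hq : q.Prime) (s : Label) (N : List Label) :
    (reduceStep q d s N).col < q ^ 2 :=
  mul_add_val_lt_sq hq (sInf_lt_of_forall_lt hq.pos fun _ hy => hy.1) _

theorem reduceStep_bounded {q d M : ℕ} (hq : q.Prime) (hM : q ^ 2 ≤ M) {s : Label}
    (h : s.Bounded M) (N : List Label) : (reduceStep q d s N).Bounded M :=
  ⟨(reduceStep_col_lt hq s N).trans_le hM, h.2⟩

theorem classStep_bounded {Q d β j M : ℕ} (hj : j < M) {s : Label} (h : s.Bounded M)
    (N : List Label) : (classStep Q d β j s N).Bounded M := by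
  unfold classStep
  split_ifs
  · exact ⟨h.1, by simpa using hj, h.2.2⟩
  · exact h

theorem finalStep_bounded {Δ Q q d j M : ℕ} (hq : 0 < q) (hM : q ≤ M) {s : Label}
    (h : s.Bounded M) (N : List Label) : (finalStep Δ Q q d j s N).Bounded M := by
  unfold finalStep
  split_ifs
  · refine ⟨h.1, h.2.1, ?_, h.2.2.2⟩
    rintro y ⟨rfl⟩
    exact (sInf_lt_of_forall_lt hq fun _ hy => hy.1).trans_le hM
  · refine ⟨h.1, h.2.1, h.2.2.1, ?_⟩
    rintro y ⟨rfl⟩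
    exact (sInf_lt_of_forall_lt hq fun _ hy => hy.1).trans_le hM
  · exact h

/-- The degree of the curves in a round of color reduction from `M` colors. -/
noncomputable def reductionDegree (Δ M : ℕ) : ℕ :=
  sInf {d | M ≤ reductionPrime Δ M ^ d ∧ Δ * d < reductionPrime Δ M}

theorem reductionDegree_spec {Δ : ℕ} (hΔ : 1 ≤ Δ) (M : ℕ) :
    M ≤ reductionPrime Δ M ^ reductionDegree Δ M ∧
      Δ * reductionDegree Δ M < reductionPrime Δ M :=
  Nat.sInf_mem (s := {d | M ≤ reductionPrime Δ M ^ d ∧ Δ * d < reductionPrime Δ M})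
    (reductionPrime_spec hΔ M).2

/-- The parameters of the coloring algorithm, as functions of the degree bound. -/
structure ColoringParams where
  /-- the number of colors to which the color reduction leads -/
  target : ℕ → ℕ
  /-- the number of neighbors in the same class that a node tolerates when it joins -/
  tolerance : ℕ → ℕ
  /-- the number of classes -/
  classes : ℕ → ℕ
  /-- the size of the field that carries the final colors -/
  field : ℕ → ℕ
  /-- the degree of the curves -/
  degree : ℕ

namespace ColoringParams

variable (p : ColoringParams)

/-- The number of rounds of color reduction. -/
noncomputable def reduction (m Δ : ℕ) : ℕ := reductionRounds (p.target Δ) Δ m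

/-- The new label of a node after round `t`. -/
noncomputable def step (m Δ t : ℕ) (s : Label) (N : List Label) : Label :=
  if t < p.reduction m Δ then
    reduceStep (reductionPrime Δ (palette Δ m t)) (reductionDegree Δ (palette Δ m t)) s N
  else if t < p.reduction m Δ + p.classes Δ then
    classStep (p.classes Δ) p.degree (p.tolerance Δ) (t - p.reduction m Δ) s N
  else
    finalStep Δ (p.classes Δ) (p.field Δ) p.degree (t - (p.reduction m Δ + p.classes Δ)) s N

/-- The color that a label stands for. -/
noncomputable def finalColor (Δ : ℕ) (s : Label) : ℕ :=
  match s.pos with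
  | none => s.col
  | some z => z * p.field Δ + (s.shifted (p.field Δ) p.degree z).val

/-- The coloring algorithm: color reduction, then the formation of classes, then the final
coloring class by class. The state consists of `m`, `Δ`, the current round, and the label. -/
noncomputable def algorithm : DistAlgorithm where
  State := ℕ × ℕ × ℕ × Label
  init m Δ i := (m, Δ, 0, Label.ofColor i)
  send s _ := s.2.2.2.toBits
  receive s l := (s.1, s.2.1, s.2.2.1 + 1,
    p.step s.1 s.2.1 s.2.2.1 s.2.2.2 (l.map (Function.invFun Label.toBits)))
  rounds m Δ := if m ≤ Δ then 0 else p.reduction m Δ + 3 * p.classes Δ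
  output s := p.finalColor s.2.1 s.2.2.2

/-! ### Correctness and message size of a run -/

section Run

variable {V : Type*} [Fintype V] {G : SimpleGraph V} [DecidableRel G.Adj] (P : PortNumbering G)
  (Δ : ℕ) {m : ℕ} (φ : G.Coloring (Fin m))

/-- The label of a node after `t` rounds. -/
noncomputable def labelAt : ℕ → V → Label
  | 0, v => Label.ofColor (φ v)
  | t + 1, v => p.step m Δ t (labelAt t v) (List.ofFn fun i => labelAt t (P v i))

theorem stateAt_eq (t : ℕ) (v : V) :
    p.algorithm.stateAt P Δ φ t v = (m, Δ, t, p.labelAt P Δ φ t v) := by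
  induction t generalizing v with
  | zero => rfl
  | succ t ih =>
    simp only [DistAlgorithm.stateAt, labelAt, ih]
    simp only [algorithm, List.map_ofFn, Function.comp_def,
      Function.leftInverse_invFun Label.toBits_injective _]

theorem result_eq (v : V) : p.algorithm.result P Δ φ v =
    p.finalColor Δ (p.labelAt P Δ φ (p.algorithm.rounds m Δ) v) := by
  rw [DistAlgorithm.result, stateAt_eq]
  rfl

variable {Δ}

theorem labelAt_bounded {M : ℕ} (hΔ : 1 ≤ Δ) (hpal : ∀ i, palette Δ m i ≤ M)
    (hclasses : p.classes Δ ≤ M) (hfield : 0 < p.field Δ) (hfieldM : p.field Δ ≤ M) (t : ℕ)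
    (v : V) : (p.labelAt P Δ φ t v).Bounded M := by
  induction t generalizing v with
  | zero =>
    refine ⟨(φ v).2.trans_le (hpal 0), ?_, ?_, ?_⟩ <;>
      exact fun y hy => absurd hy (by simp [labelAt, Label.ofColor])
  | succ t ih =>
    rw [labelAt, step]
    split_ifs with h1 h2
    · exact reduceStep_bounded (reductionPrime_spec hΔ _).1
        (by rw [← palette_succ]; exact hpal _) (ih v) _
    · exact classStep_bounded (by omega) (ih v) _
    · exact finalStep_bounded hfield hfieldM (ih v) _

theorem reduction_phase (hΔ : 1 ≤ Δ) (hdeg : ∀ v, G.degree v ≤ Δ) (t : ℕ)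
    (ht : t ≤ p.reduction m Δ) :
    ∃ ψ : V → ℕ, (∀ v, p.labelAt P Δ φ t v = Label.ofColor (ψ v)) ∧
      (∀ v, ψ v < palette Δ m t) ∧ ∀ v i, ψ (P v i) ≠ ψ v := by
  induction t with
  | zero =>
    refine ⟨fun v => φ v, fun v => rfl, fun v => (φ v).2, fun v i h => ?_⟩
    exact φ.valid (P v i).2 (Fin.ext h).symm
  | succ t ih =>
    obtain ⟨ψ, h1, h2, h3⟩ := ih (by omega)
    have hM := palette_succ Δ m t
    obtain ⟨hq, -⟩ := reductionPrime_spec hΔ (palette Δ m t)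
    obtain ⟨hd1, hd2⟩ := reductionDegree_spec hΔ (palette Δ m t)
    have hstep : ∀ v, p.labelAt P Δ φ (t + 1) v =
        reduceStep (reductionPrime Δ (palette Δ m t)) (reductionDegree Δ (palette Δ m t))
          (Label.ofColor (ψ v)) (List.ofFn fun i => Label.ofColor (ψ (P v i))) := by
      intro v
      rw [labelAt, step, if_pos (by omega)]
      simp only [h1]
    refine ⟨fun v => (p.labelAt P Δ φ (t + 1) v).col, fun v => ?_, fun v => ?_, fun v i => ?_⟩
    · simp only [hstep]
      rfl
    · simp only [hstep, hM]
      exact reduceStep_col_lt hq _ _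
    · simp only [hstep]
      exact reduceStep_proper (deg := fun v => G.degree v) (nb := fun v i => (P v i : V))
        (σ := fun v => Label.ofColor (ψ v)) hq hd1 hd2 hdeg h2 h3 v i

theorem port_symm (v : V) (i : Fin (G.degree v)) : ∃ j, (P (P v i) j : V) = v :=
  ⟨(P (P v i)).symm ⟨v, (P v i).2.symm⟩, by simp⟩

theorem exists_port {u v : V} (h : G.Adj u v) : ∃ i, (P u i : V) = v :=
  ⟨(P u).symm ⟨v, h⟩, by simp⟩

/-- If there is no formation of classes, the outputs are the colors after the color reduction. -/
theorem result_of_classes_eq_zero (hΔ : 1 ≤ Δ) (hdeg : ∀ v, G.degree v ≤ Δ)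
    (hcl : p.classes Δ = 0) (ht : 324 * Δ ^ 2 ≤ p.target Δ) :
    (∀ u v, G.Adj u v → p.algorithm.result P Δ φ u ≠ p.algorithm.result P Δ φ v) ∧
      ∀ v, p.algorithm.result P Δ φ v < p.target Δ := by
  have hr : p.algorithm.rounds m Δ = if m ≤ Δ then 0 else p.reduction m Δ := by
    simp [algorithm, hcl]
  obtain ⟨ψ, h1, h2, h3⟩ := p.reduction_phase P φ hΔ hdeg (p.algorithm.rounds m Δ)
    (by rw [hr]; split_ifs <;> omega)
  have hres : ∀ v, p.algorithm.result P Δ φ v = ψ v := fun v => by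
    rw [result_eq, h1]
    rfl
  simp only [hres]
  refine ⟨fun u v huv h => ?_, fun v => (h2 v).trans_le ?_⟩
  · obtain ⟨i, rfl⟩ := exists_port P huv
    exact h3 u i h.symm
  · rw [hr]
    split_ifs with hm
    · rw [palette_zero]
      nlinarith
    · exact palette_reductionRounds_le hΔ ht m

theorem result_of_classes_prime (hΔ : 1 ≤ Δ) (hdeg : ∀ v, G.degree v ≤ Δ)
    (ht : 324 * Δ ^ 2 ≤ p.target Δ) (hQ : (p.classes Δ).Prime) (hq : (p.field Δ).Prime)
    (hQβ : 2 * p.degree * Δ < p.classes Δ * (p.tolerance Δ + 1))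
    (hQt : p.target Δ < p.classes Δ ^ p.degree) (hqt : p.target Δ ≤ p.field Δ ^ p.degree)
    (hqβ : 2 * p.tolerance Δ * p.degree < p.field Δ) (hqΔ : 2 * Δ < p.field Δ ^ 2) :
    (∀ u v, G.Adj u v → p.algorithm.result P Δ φ u ≠ p.algorithm.result P Δ φ v) ∧
      ∀ v, p.algorithm.result P Δ φ v < p.field Δ ^ 2 := by
  -- Here no round takes place and the input colors are returned; they are below `q ^ 2` since `2 *
  -- Δ < q ^ 2`.
  by_cases hm : m ≤ Δ
  · have hr : p.algorithm.rounds m Δ = 0 := by simp [algorithm, hm]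
    have hres : ∀ v, p.algorithm.result P Δ φ v = φ v := fun v => by
      rw [result_eq, hr]
      rfl
    simp only [hres]
    refine ⟨fun u v huv h => φ.valid huv (Fin.ext h), fun v => ?_⟩
    have := (φ v).2
    omega
  have hr : p.algorithm.rounds m Δ = p.reduction m Δ + p.classes Δ + 2 * p.classes Δ := by
    simp only [algorithm, if_neg hm]
    ring
  obtain ⟨ψ, h1, h2, h3⟩ := p.reduction_phase P φ hΔ hdeg _ le_rfl
  have h2 : ∀ v, ψ v < p.target Δ :=
    fun v => (h2 v).trans_le (palette_reductionRounds_le hΔ ht m)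
  obtain ⟨x, -, hx, hcard⟩ := classes_of_classStep (deg := fun v => G.degree v)
    (nb := fun v i => (P v i : V)) (τ := fun j => p.labelAt P Δ φ (p.reduction m Δ + j)) hQ hdeg
    hQβ (fun v => (Nat.succ_le_of_lt (h2 v)).trans_lt hQt) h3 h1 (by
      intro j hj v
      rw [← add_assoc, labelAt, step, if_neg (by omega), if_pos (by omega),
        Nat.add_sub_cancel_left])
  obtain ⟨a, z, hzq, hz, hproper⟩ := coloring_of_finalStep (deg := fun v => G.degree v)
    (nb := fun v i => (P v i : V))
    (τ := fun j => p.labelAt P Δ φ (p.reduction m Δ + p.classes Δ + j)) hQ hq hdeg (port_symm P)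
    hqβ hqΔ (fun v => (h2 v).trans_le hqt) h3 hcard hx (by
      intro j hj v
      rw [← add_assoc, labelAt, step, if_neg (by omega), if_neg (by omega),
        Nat.add_sub_cancel_left])
  have hres : ∀ v, p.algorithm.result P Δ φ v = z v * p.field Δ +
      (curve (p.field Δ) p.degree (ψ v) (z v) + (a v : ZMod (p.field Δ))).val := fun v => by
    rw [result_eq, hr, hz]
    rfl
  simp only [hres]
  refine ⟨fun u v huv h => ?_, fun v => mul_add_val_lt_sq hq (hzq v) _⟩
  obtain ⟨i, rfl⟩ := exists_port P huv
  obtain ⟨e1, e2⟩ := mul_add_val_injective hq h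
  refine hproper u i e1.symm ?_
  rw [← e1] at e2
  exact e2.symm

/-- All messages have `O(log n)` bits. -/
theorem exists_messagesBounded (C : ℕ) (hC : ∀ Δ, 1 ≤ Δ → p.classes Δ ≤ C * Δ)
    (hq : ∀ Δ, 1 ≤ Δ → 0 < p.field Δ) (hqC : ∀ Δ, 1 ≤ Δ → p.field Δ ≤ C * Δ) (c : ℕ) :
    ∃ B : ℕ, ∀ (V : Type*) [Fintype V] (G : SimpleGraph V) [DecidableRel G.Adj]
      (P : PortNumbering G) (Δ m : ℕ) (φ : G.Coloring (Fin m)),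
      1 ≤ Δ → m ≤ Fintype.card V ^ c →
        p.algorithm.MessagesBounded P Δ φ (B * Nat.clog 2 (Fintype.card V)) := by
  obtain ⟨e, he⟩ : ∃ e, C + 326 ≤ 2 ^ e := ⟨_, Nat.lt_two_pow_self.le⟩
  refine ⟨(e + 3) * 8 * c, ?_⟩
  intro V _ G _ P Δ m φ hΔ hm t ht v i
  -- Messages are sent only if `Δ < m`, so quantities polynomial in `Δ` have `O(log m)` bits. This
  -- also gives `2 ≤ m`, so constants are bounded by powers of `m`.
  have hmΔ : Δ < m := by
    by_contra! h
    simp [algorithm, h] at ht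
  rw [stateAt_eq]
  change (p.labelAt P Δ φ t v).code.bits.length ≤ _
  rw [Nat.size_eq_bits_len, Nat.size_le]
  have hm1 : 1 ≤ m := by omega
  set M := (C + 325) * m ^ 3 with hM
  have hm3 : m ≤ m ^ 3 := Nat.le_self_pow (by norm_num) m
  have hCm : C * Δ ≤ M := by
    rw [hM]
    exact Nat.mul_le_mul (by omega) (hmΔ.le.trans hm3)
  have hpal : ∀ i, palette Δ m i ≤ M := by
    intro i
    refine (palette_le_add hΔ m i).trans ?_
    calc Δ ^ 2 * (m + 324) ≤ m ^ 2 * ((C + 325) * m) :=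
          Nat.mul_le_mul (Nat.pow_le_pow_left hmΔ.le 2) (by nlinarith)
      _ = M := by rw [hM]; ring
  have hb := p.labelAt_bounded P φ hΔ hpal ((hC Δ hΔ).trans hCm) (hq Δ hΔ) ((hqC Δ hΔ).trans hCm) t v
  have hM1 : M + 1 ≤ m ^ (e + 3) := by
    calc M + 1 ≤ (C + 326) * m ^ 3 := by rw [hM]; nlinarith
      _ ≤ 2 ^ e * m ^ 3 := Nat.mul_le_mul_right _ he
      _ ≤ m ^ e * m ^ 3 := Nat.mul_le_mul_right _ (Nat.pow_le_pow_left (by omega) e)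
      _ = m ^ (e + 3) := by ring
  calc _ < (M + 1) ^ 8 := hb.code_lt
    _ ≤ (m ^ (e + 3)) ^ 8 := Nat.pow_le_pow_left hM1 8
    _ = m ^ ((e + 3) * 8) := (pow_mul _ _ _).symm
    _ ≤ ((2 ^ Nat.clog 2 (Fintype.card V)) ^ c) ^ ((e + 3) * 8) := by
        refine Nat.pow_le_pow_left (hm.trans (Nat.pow_le_pow_left ?_ c)) _
        exact Nat.le_pow_clog (by norm_num) _
    _ = 2 ^ ((e + 3) * 8 * c * Nat.clog 2 (Fintype.card V)) := by
        rw [← pow_mul, ← pow_mul]; congr 1; ring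

end Run

end ColoringParams

/-! ### Choice of the parameters -/

/-- If the target is below `a * Δ ^ 2`, then `X = Δ ^ (1/2 - ε/2)` is not small: `X ^ 2 * Δ ^ (1 +
ε) = Δ ^ 2` gives `1 ≤ a * X ^ 2 ≤ a * X`. So the `a` extra rounds number at most `a ^ 2 * X`. -/
theorem rounds_le_of_one_le {ε : ℝ} (hε : 1 ≤ ε) {Δ a T L : ℕ} (hΔ : 1 ≤ Δ)
    (h1 : T ≤ L + a)
    (h2 : a * Δ ^ 2 ≤ ⌊324 * (Δ : ℝ) ^ (1 + ε)⌋₊ → T ≤ L) :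
    (T : ℝ) ≤ (a : ℝ) ^ 2 * (Δ : ℝ) ^ (1 / 2 - ε / 2) + L := by
  have hΔ' : (1 : ℝ) ≤ Δ := by exact_mod_cast hΔ
  have hΔ0 : (0 : ℝ) < Δ := by linarith
  set X := (Δ : ℝ) ^ (1 / 2 - ε / 2) with hX
  have hX0 : 0 < X := Real.rpow_pos_of_pos hΔ0 _
  by_cases h : a * Δ ^ 2 ≤ ⌊324 * (Δ : ℝ) ^ (1 + ε)⌋₊
  · have : (T : ℝ) ≤ L := by exact_mod_cast h2 h
    nlinarith [mul_nonneg (sq_nonneg (a : ℝ)) hX0.le]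
  · have h3 := Nat.lt_of_floor_lt (not_le.1 h)
    push_cast at h3
    have hX1 : X ≤ 1 := Real.rpow_le_one_of_one_le_of_nonpos hΔ' (by linarith)
    have hmul : X ^ 2 * (Δ : ℝ) ^ (1 + ε) = (Δ : ℝ) ^ 2 := by
      rw [hX, ← Real.rpow_natCast, ← Real.rpow_mul hΔ0.le, ← Real.rpow_add hΔ0,
        ← Real.rpow_natCast]
      congr 1
      push_cast
      ring
    have h4 : 1 ≤ a * X ^ 2 := by
      have h5 := mul_le_mul_of_nonneg_left h3.le (sq_nonneg X)
      have h6 : 0 < (Δ : ℝ) ^ 2 := by positivity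
      have h7 : (324 : ℝ) * (Δ : ℝ) ^ 2 ≤ a * X ^ 2 * (Δ : ℝ) ^ 2 := by
        calc (324 : ℝ) * (Δ : ℝ) ^ 2 = X ^ 2 * (324 * (Δ : ℝ) ^ (1 + ε)) := by rw [← hmul]; ring
          _ ≤ X ^ 2 * (a * (Δ : ℝ) ^ 2) := h5
          _ = _ := by ring
      have := le_of_mul_le_mul_right h7 h6
      linarith
    have ha0 : (0 : ℝ) ≤ a := by positivity
    have h8 : 1 ≤ a * X := h4.trans (by gcongr; nlinarith)
    have h9 : (T : ℝ) ≤ L + a := by exact_mod_cast h1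
    nlinarith [mul_le_mul_of_nonneg_left h8 ha0]

/-- The parameters for `ε ≥ 1`: the color reduction alone suffices. -/
noncomputable def ColoringParams.reductionOnly (ε : ℝ) : ColoringParams where
  target Δ := ⌊324 * (Δ : ℝ) ^ (1 + ε)⌋₊
  tolerance _ := 0
  classes _ := 0
  field _ := 1
  degree := 0

/-- A prime between `k + 1` and `2 * k`. -/
noncomputable def bertrandPrime (k : ℕ) : ℕ := sInf {q | q.Prime ∧ k < q ∧ q ≤ 2 * k}

theorem bertrandPrime_spec {k : ℕ} (hk : k ≠ 0) :
    (bertrandPrime k).Prime ∧ k < bertrandPrime k ∧ bertrandPrime k ≤ 2 * k :=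
  Nat.sInf_mem (s := {q | q.Prime ∧ k < q ∧ q ≤ 2 * k}) (Nat.exists_prime_lt_and_le_two_mul k hk)

/-- The degree of the curves for `ε < 1`. -/
noncomputable def curveDegree (ε : ℝ) : ℕ := ⌈2 / (1 / 2 - ε / 2)⌉₊ + 9

/-- The parameters for `ε < 1`. -/
noncomputable def ColoringParams.full (ε : ℝ) : ColoringParams where
  target Δ := 324 * Δ ^ 2
  tolerance Δ := ⌈(Δ : ℝ) ^ (1 / 2 + ε / 2)⌉₊
  classes Δ := bertrandPrime (2 * curveDegree ε * ⌈(Δ : ℝ) ^ (1 / 2 - ε / 2)⌉₊)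
  field Δ := bertrandPrime (2 * ⌈(Δ : ℝ) ^ (1 / 2 + ε / 2)⌉₊ * curveDegree ε)
  degree := curveDegree ε

theorem natCeil_rpow_le_two_mul {Δ : ℕ} (hΔ : 1 ≤ Δ) {e : ℝ} (he : 0 ≤ e) :
    (⌈(Δ : ℝ) ^ e⌉₊ : ℝ) ≤ 2 * (Δ : ℝ) ^ e := by
  have h1 : (1 : ℝ) ≤ (Δ : ℝ) ^ e := Real.one_le_rpow (by exact_mod_cast hΔ) he
  have := Nat.ceil_lt_add_one (zero_le_one.trans h1)
  linarith

theorem natCeil_rpow_le_self {Δ : ℕ} (hΔ : 1 ≤ Δ) {e : ℝ} (he : e ≤ 1) :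
    ⌈(Δ : ℝ) ^ e⌉₊ ≤ Δ :=
  Nat.ceil_le.2 (Real.rpow_le_self_of_one_le (by exact_mod_cast hΔ) he)

theorem one_le_natCeil_rpow {Δ : ℕ} (hΔ : 1 ≤ Δ) (e : ℝ) : 1 ≤ ⌈(Δ : ℝ) ^ e⌉₊ :=
  Nat.one_le_ceil_iff.2 (Real.rpow_pos_of_pos (by exact_mod_cast hΔ) e)

theorem pow_le_natCeil_rpow_pow {Δ : ℕ} (hΔ : 1 ≤ Δ) {e : ℝ} {k l : ℕ} (h : k ≤ e * l) :
    Δ ^ k ≤ ⌈(Δ : ℝ) ^ e⌉₊ ^ l := by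
  have hΔ' : (1 : ℝ) ≤ Δ := by exact_mod_cast hΔ
  have : (Δ : ℝ) ^ k ≤ (⌈(Δ : ℝ) ^ e⌉₊ : ℝ) ^ l := by
    calc (Δ : ℝ) ^ k = (Δ : ℝ) ^ (k : ℝ) := (Real.rpow_natCast _ _).symm
      _ ≤ (Δ : ℝ) ^ (e * l) := Real.rpow_le_rpow_of_exponent_le hΔ' h
      _ = ((Δ : ℝ) ^ e) ^ l := Real.rpow_mul_natCast (by linarith) _ _
      _ ≤ _ := by gcongr; exact Nat.le_ceil _
  exact_mod_cast this

theorem le_natCeil_rpow_mul_natCeil_rpow {Δ : ℕ} (hΔ : 1 ≤ Δ) {e f : ℝ} (h : e + f = 1) :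
    Δ ≤ ⌈(Δ : ℝ) ^ e⌉₊ * ⌈(Δ : ℝ) ^ f⌉₊ := by
  have hΔ' : (0 : ℝ) < Δ := by exact_mod_cast hΔ
  have : (Δ : ℝ) ≤ (⌈(Δ : ℝ) ^ e⌉₊ : ℝ) * ⌈(Δ : ℝ) ^ f⌉₊ := by
    calc (Δ : ℝ) = (Δ : ℝ) ^ e * (Δ : ℝ) ^ f := by rw [← Real.rpow_add hΔ', h, Real.rpow_one]
      _ ≤ _ := by gcongr <;> exact Nat.le_ceil _
  exact_mod_cast this

theorem theorem3 (ε : ℝ) (hε : 0 < ε) :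
    ∃ (A : DistAlgorithm) (K : ℝ), ∀ c : ℕ, ∃ (B : ℕ) (R : ℝ),
      ∀ (V : Type*) [Fintype V] (G : SimpleGraph V) [DecidableRel G.Adj] (P : PortNumbering G)
        (Δ m : ℕ) (φ : G.Coloring (Fin m)),
        1 ≤ Δ → (∀ v, G.degree v ≤ Δ) → m ≤ Fintype.card V ^ c →
          -- `O(Δ^(1/2 - ε/2)) + log* n` rounds
          (A.rounds m Δ : ℝ) ≤ R * (Δ : ℝ) ^ (1 / 2 - ε / 2) + logStar (Fintype.card V) ∧
          -- messages of `O(log n)` bits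
          A.MessagesBounded P Δ φ (B * Nat.clog 2 (Fintype.card V)) ∧
          -- the outputs form a proper coloring with `O(Δ^(1 + ε))` colors
          (∀ u v, G.Adj u v → A.result P Δ φ u ≠ A.result P Δ φ v) ∧
          (∀ v, (A.result P Δ φ v : ℝ) < K * (Δ : ℝ) ^ (1 + ε)) := by
  rcases le_or_gt 1 ε with h1 | h1
  · refine ⟨(ColoringParams.reductionOnly ε).algorithm, 324, fun c => ?_⟩
    obtain ⟨a, ha⟩ := exists_reductionRounds_le c
    obtain ⟨B, hB⟩ := (ColoringParams.reductionOnly ε).exists_messagesBounded 1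
      (fun _ _ => Nat.zero_le _) (fun _ _ => Nat.one_pos)
      (fun Δ hΔ => by simpa [ColoringParams.reductionOnly] using hΔ) c
    refine ⟨B, (a : ℝ) ^ 2, fun V _ G _ P Δ m φ hΔ hdeg hm => ?_⟩
    have hΔ' : (1 : ℝ) ≤ Δ := by exact_mod_cast hΔ
    have ht : 324 * Δ ^ 2 ≤ (ColoringParams.reductionOnly ε).target Δ := by
      refine Nat.le_floor ?_
      push_cast
      gcongr
      rw [← Real.rpow_natCast]
      exact Real.rpow_le_rpow_of_exponent_le hΔ' (by push_cast; linarith)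
    obtain ⟨hproper, hlt⟩ :=
      (ColoringParams.reductionOnly ε).result_of_classes_eq_zero P φ hΔ hdeg rfl ht
    obtain ⟨hr1, hr2⟩ := ha (Fintype.card V) m Δ _ hΔ hm ht
    refine ⟨?_, hB V G P Δ m φ hΔ hm, hproper, fun v => ?_⟩
    · refine rounds_le_of_one_le h1 hΔ (le_trans ?_ hr1) fun h => le_trans ?_ (hr2 h)
      all_goals
        change (if m ≤ Δ then 0 else _) ≤ _
        split_ifs
        · exact Nat.zero_le _
        · exact le_rfl
    · have hv : (_ : ℝ) < ((ColoringParams.reductionOnly ε).target Δ : ℝ) := Nat.cast_lt.2 (hlt v)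
      exact hv.trans_le (Nat.floor_le (by positivity))
  · set d := curveDegree ε with hd
    have hd9 : 9 ≤ d := Nat.le_add_left _ _
    have hδ : 0 < 1 / 2 - ε / 2 := by linarith
    have hδd : 2 ≤ (1 / 2 - ε / 2) * d := by
      have h2 := Nat.le_ceil (2 / (1 / 2 - ε / 2))
      have h3 : (d : ℝ) = ⌈2 / (1 / 2 - ε / 2)⌉₊ + 9 := by rw [hd, curveDegree]; push_cast; rfl
      rw [div_le_iff₀ hδ] at h2
      rw [h3]
      nlinarith
    set p := ColoringParams.full ε with hp
    have hQ : ∀ Δ, 1 ≤ Δ → (p.classes Δ).Prime ∧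
        2 * d * ⌈(Δ : ℝ) ^ (1 / 2 - ε / 2)⌉₊ < p.classes Δ ∧
        p.classes Δ ≤ 2 * (2 * d * ⌈(Δ : ℝ) ^ (1 / 2 - ε / 2)⌉₊) := by
      intro Δ hΔ
      have := one_le_natCeil_rpow hΔ (1 / 2 - ε / 2)
      exact bertrandPrime_spec (by positivity)
    have hq : ∀ Δ, 1 ≤ Δ → (p.field Δ).Prime ∧
        2 * p.tolerance Δ * d < p.field Δ ∧ p.field Δ ≤ 2 * (2 * p.tolerance Δ * d) := by
      intro Δ hΔ
      have : 1 ≤ p.tolerance Δ := one_le_natCeil_rpow hΔ (1 / 2 + ε / 2)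
      exact bertrandPrime_spec (by positivity)
    -- The field size is at most `4 * d * β ≤ 8 * d * Δ ^ (1/2 + ε/2)`; its square gives this
    -- constant.
    refine ⟨p.algorithm, 64 * (d : ℝ) ^ 2, fun c => ?_⟩
    obtain ⟨a, ha⟩ := exists_reductionRounds_le c
    obtain ⟨B, hB⟩ := p.exists_messagesBounded (4 * d)
      (fun Δ hΔ => (hQ Δ hΔ).2.2.trans (by
        have := natCeil_rpow_le_self hΔ (e := 1 / 2 - ε / 2) (by linarith)
        nlinarith))
      (fun Δ hΔ => (hq Δ hΔ).1.pos)
      (fun Δ hΔ => (hq Δ hΔ).2.2.trans (by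
        have : p.tolerance Δ ≤ Δ := natCeil_rpow_le_self hΔ (e := 1 / 2 + ε / 2) (by linarith)
        nlinarith)) c
    -- The `a` extra reduction rounds are absorbed as `Δ ^ (1/2 - ε/2) ≥ 1`; the other rounds number
    -- at most `3 * (4 * d * s)`, where `s ≤ 2 * Δ ^ (1/2 - ε/2)`.
    refine ⟨B, a + 24 * d, fun V _ G _ P Δ m φ hΔ hdeg hm => ?_⟩
    have hΔ' : (1 : ℝ) ≤ Δ := by exact_mod_cast hΔ
    obtain ⟨hQp, hQlt, hQle⟩ := hQ Δ hΔ
    obtain ⟨hqp, hqlt, hqle⟩ := hq Δ hΔ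
    set s := ⌈(Δ : ℝ) ^ (1 / 2 - ε / 2)⌉₊ with hs
    have hsβ : Δ ≤ s * p.tolerance Δ := le_natCeil_rpow_mul_natCeil_rpow hΔ (by ring)
    have hsd : Δ ^ 2 ≤ s ^ d := pow_le_natCeil_rpow_pow hΔ (by exact_mod_cast hδd)
    have hβ1 : 1 ≤ p.tolerance Δ := one_le_natCeil_rpow hΔ _
    have hβ2 : Δ ^ 1 ≤ p.tolerance Δ ^ 2 := pow_le_natCeil_rpow_pow hΔ (by push_cast; linarith)
    have hβd : Δ ^ 2 ≤ p.tolerance Δ ^ d :=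
      pow_le_natCeil_rpow_pow hΔ (by
        push_cast
        nlinarith [mul_nonneg hε.le (Nat.cast_nonneg (α := ℝ) d)])
    have h2β : 2 * p.tolerance Δ ≤ p.field Δ := by nlinarith
    -- The summand 9 in `curveDegree` serves this: `2 ^ 9 = 512` absorbs the factor `324` of the
    -- target, while the other summand makes `s ^ d` and `β ^ d` at least `Δ ^ 2`.
    have h2d : 324 < 2 ^ d := lt_of_lt_of_le (by norm_num) (Nat.pow_le_pow_right two_pos hd9)
    have hpow : ∀ b k : ℕ, Δ ^ 2 ≤ b ^ d → 2 * b ≤ k → 324 * Δ ^ 2 < k ^ d := by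
      intro b k hb hk
      have hb0 : 0 < Δ ^ 2 := by positivity
      calc 324 * Δ ^ 2 < 2 ^ d * Δ ^ 2 := Nat.mul_lt_mul_of_pos_right h2d hb0
        _ ≤ 2 ^ d * b ^ d := Nat.mul_le_mul_left _ hb
        _ = (2 * b) ^ d := (mul_pow _ _ _).symm
        _ ≤ k ^ d := Nat.pow_le_pow_left hk d
    have ht : 324 * Δ ^ 2 ≤ p.target Δ := le_rfl
    obtain ⟨hproper, hlt⟩ := p.result_of_classes_prime P φ hΔ hdeg ht hQp hqp
      (by
        change 2 * d * Δ < _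
        calc 2 * d * Δ ≤ 2 * d * (s * p.tolerance Δ) := Nat.mul_le_mul_left _ hsβ
          _ = 2 * d * s * p.tolerance Δ := by ring
          _ ≤ p.classes Δ * p.tolerance Δ := Nat.mul_le_mul_right _ hQlt.le
          _ < p.classes Δ * (p.tolerance Δ + 1) :=
            Nat.mul_lt_mul_of_pos_left (Nat.lt_succ_self _) hQp.pos)
      (hpow s _ hsd (by nlinarith))
      (hpow (p.tolerance Δ) _ hβd h2β).le hqlt (by
        calc 2 * Δ ≤ 2 * p.tolerance Δ ^ 2 := by rw [pow_one] at hβ2; omega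
          _ < (2 * p.tolerance Δ) ^ 2 := by nlinarith
          _ ≤ _ := Nat.pow_le_pow_left h2β 2)
    obtain ⟨hr1, -⟩ := ha (Fintype.card V) m Δ _ hΔ hm ht
    refine ⟨?_, hB V G P Δ m φ hΔ hm, hproper, fun v => ?_⟩
    · have hr : p.algorithm.rounds m Δ ≤ logStar (Fintype.card V) + a + 3 * (4 * d * s) := by
        change (if m ≤ Δ then 0 else _) ≤ _
        split_ifs
        · exact Nat.zero_le _
        · refine Nat.add_le_add hr1 (Nat.mul_le_mul_left 3 (hQle.trans_eq ?_))
          ring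
      have hr' : (p.algorithm.rounds m Δ : ℝ) ≤
          logStar (Fintype.card V) + a + 3 * (4 * d * s) := by exact_mod_cast hr
      have hs2 : (s : ℝ) ≤ 2 * (Δ : ℝ) ^ (1 / 2 - ε / 2) := natCeil_rpow_le_two_mul hΔ hδ.le
      have hX1 : (1 : ℝ) ≤ (Δ : ℝ) ^ (1 / 2 - ε / 2) := Real.one_le_rpow hΔ' hδ.le
      have ha0 : (0 : ℝ) ≤ a := by positivity
      have hd0 : (0 : ℝ) ≤ d := by positivity
      nlinarith [mul_le_mul_of_nonneg_left hs2 hd0, mul_le_mul_of_nonneg_left hX1 ha0]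
    · have hβ' : (p.tolerance Δ : ℝ) ≤ 2 * (Δ : ℝ) ^ (1 / 2 + ε / 2) :=
        natCeil_rpow_le_two_mul hΔ (by linarith)
      have hv : (p.algorithm.result P Δ φ v : ℝ) < (p.field Δ : ℝ) ^ 2 := by
        exact_mod_cast hlt v
      have hf : (p.field Δ : ℝ) ≤ 2 * (2 * p.tolerance Δ * d) := by exact_mod_cast hqle
      have hf' : (p.field Δ : ℝ) ≤ 8 * d * (Δ : ℝ) ^ (1 / 2 + ε / 2) := by
        calc (p.field Δ : ℝ) ≤ 2 * (2 * p.tolerance Δ * d) := hf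
          _ = 4 * d * p.tolerance Δ := by ring
          _ ≤ 4 * d * (2 * (Δ : ℝ) ^ (1 / 2 + ε / 2)) := by gcongr
          _ = _ := by ring
      calc _ < (p.field Δ : ℝ) ^ 2 := hv
        _ ≤ (8 * d * (Δ : ℝ) ^ (1 / 2 + ε / 2)) ^ 2 := by gcongr
        _ = 64 * (d : ℝ) ^ 2 * ((Δ : ℝ) ^ (1 / 2 + ε / 2)) ^ 2 := by ring
        _ = 64 * (d : ℝ) ^ 2 * (Δ : ℝ) ^ (1 + ε) := by
            rw [← Real.rpow_mul_natCast (by linarith)]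
            congr 2
            push_cast
            ring
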